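/- Let $Df(\rho)=\frac1\rho f'(\rho)$ and $Kf(\rho)=\int_0^\rho s f(s)\,ds$ for complex-valued functions $f$ on $[0,1]$. Let $$\tilde{\mathcal H}=\{(u_1,u_2)\in C^4[0,1]\times C^1[0,1]:\ u_1^{(k)}(0)=u_2(0)=0,\ k=0,1,2,3\}$$ with the inner product $$(\mathbf u|\mathbf v)=\int_0^1 D^2u_1(\rho)\,\overline{D^2v_1(\rho)}\,d\rho+\int_0^1u_2'(\rho)\,\overline{v_2'(\rho)}\,d\rho,$$ and let $\mathcal H$ be the Hilbert space obtained as the completion of $\tilde{\mathcal H}$. On $$\mathcal D(\tilde{\mathbf L}_0)=\{(u_1,u_2)\in C^\infty[0,1]\times C^\infty[0,1]:\ u_1^{(k)}(0)=u_2(0)=0,\ k=0,1,2,3,4\}\subset\tilde{\mathcal H}$$ define the operator $\tilde{\mathbf L}_0$, which maps into $\tilde{\mathcal H}$, by $$\tilde{\mathbf L}_0\mathbf u(\rho)=\begin{pmatrix}-\rho u_1'(\rho)+2u_1(\rho)+\rho^2u_2(\rho)-3Ku_2(\rho)\\ D^2u_1(\rho)-\rho u_2'(\rho)-u_2(\rho)\end{pmatrix}.$$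 Then the operator $\tilde{\mathbf L}_0:\mathcal D(\tilde{\mathbf L}_0)\subset\mathcal H\to\mathcal H$ is closable, and its closure $\mathbf L_0$ generates a strongly continuous one-parameter semigroup $\mathbf S_0:[0,\infty)\to\mathcal B(\mathcal H)$ that satisfies $$\|\mathbf S_0(\tau)\|\le e^{-\frac32\tau}\qquad\text{for all }\tau\ge0.$$ In particular, for every $\mathbf u\in\mathcal H$, the Cauchy problem $\frac{d}{d\tau}\Phi(\tau)=\mathbf L_0\Phi(\tau)$, $\Phi(0)=\mathbf u$, has a unique mild solution $\Phi:[0,\infty)\to\mathcal H$, namely $\Phi(\tau)=\mathbf S_0(\tau)\mathbf u$. Here a mild solution is a continuous function $\Phi$ such that, for all $\tau\ge0$, $\int_0^\tau\Phi(s)\,ds\in\mathcal D(\mathbf L_0)$ and $\Phi(\tau)=\mathbf L_0\int_0^\tau\Phi(s)\,ds+\mathbf u$. -/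

import Mathlib

open Set Filter Topology MeasureTheory
open scoped ContDiff NNReal

noncomputable section

namespace YangMills

/-- The operator `D f(ρ) = f'(ρ) / ρ` on functions on `[0,1]`; the derivative is the one relative to
`[0,1]`, hence one-sided at the end points. The value at `ρ = 0` is `0` by convention. -/
def opD (f : ℝ → ℂ) (ρ : ℝ) : ℂ := (1 / (ρ : ℂ)) * derivWithin f (Icc 0 1) ρ

/-- The integral operator `K f(ρ) = ∫₀^ρ s f(s) ds`. -/
def opK (f : ℝ → ℂ) (ρ : ℝ) : ℂ := ∫ s in (0 : ℝ)..ρ, (s : ℂ) * f s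

theorem uniqueDiff_I : UniqueDiffOn ℝ (Icc (0 : ℝ) 1) := uniqueDiffOn_Icc zero_lt_one

theorem hasDerivWithinAt_iter {f : ℝ → ℂ} {n : ℕ∞ω} {k : ℕ} (hf : ContDiffOn ℝ n f (Icc 0 1))
    (hk : (k : ℕ∞ω) < n) {x : ℝ} (hx : x ∈ Icc (0 : ℝ) 1) :
    HasDerivWithinAt (iteratedDerivWithin k f (Icc 0 1))
      (iteratedDerivWithin (k + 1) f (Icc 0 1) x) (Icc 0 1) x := by
  rw [iteratedDerivWithin_succ]
  exact (hf.differentiableOn_iteratedDerivWithin hk uniqueDiff_I x hx).hasDerivWithinAt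

theorem isLittleO_step {h h' : ℝ → ℂ} {c : ℂ} {n : ℕ}
    (hd : ∀ x ∈ Icc (0 : ℝ) 1, HasDerivWithinAt h (h' x) (Icc 0 1) x) (h0 : h 0 = 0)
    (ho : (fun x : ℝ => h' x - c * (x : ℂ) ^ n) =o[𝓝[Icc 0 1] (0 : ℝ)] fun x : ℝ => x ^ n) :
    (fun x : ℝ => h x - c / (n + 1) * (x : ℂ) ^ (n + 1))
      =o[𝓝[Icc 0 1] (0 : ℝ)] fun x : ℝ => x ^ (n + 1) := by
  rw [Asymptotics.isLittleO_iff] at ho ⊢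
  intro ε hε
  have h1 := ho hε
  rw [nhdsWithin_Icc_eq_nhdsGE zero_lt_one] at h1 ⊢
  obtain ⟨δ, hδ, hδs⟩ := (mem_nhdsGE_iff_exists_Ico_subset).1 h1
  have hδ0 : (0 : ℝ) < δ := hδ
  have hm : Ico (0 : ℝ) (min δ 1) ∈ 𝓝[≥] (0 : ℝ) := Ico_mem_nhdsGE (lt_min hδ0 one_pos)
  filter_upwards [hm] with x hx
  have hx1 : x < 1 := lt_of_lt_of_le hx.2 (min_le_right _ _)
  have hxδ : x < δ := lt_of_lt_of_le hx.2 (min_le_left _ _)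
  have hg : ∀ y ∈ Icc (0 : ℝ) x, HasDerivWithinAt
      (fun y : ℝ => h y - c / (n + 1) * (y : ℂ) ^ (n + 1)) (h' y - c * (y : ℂ) ^ n)
      (Icc 0 x) y := by
    intro y hy
    have e1 := (hd y ⟨hy.1, hy.2.trans hx1.le⟩).mono (Icc_subset_Icc_right hx1.le)
    have e2 : HasDerivAt (fun y : ℝ => (y : ℂ) ^ (n + 1)) ((n + 1 : ℕ) * (y : ℂ) ^ n * 1) y :=
      HasDerivAt.pow (Complex.ofRealCLM.hasDerivAt) (n + 1)
    have e3 := (e1.sub ((e2.const_mul (c / (n + 1))).hasDerivWithinAt (s := Icc 0 x)))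
    convert! e3 using 1
    have : ((n : ℂ) + 1) ≠ 0 := Nat.cast_add_one_ne_zero n
    push_cast
    field_simp
  have := norm_image_sub_le_of_norm_deriv_le_segment' (C := ε * x ^ n) hg (by
    intro y hy
    have := hδs (show y ∈ Ico 0 δ from ⟨hy.1, hy.2.trans hxδ⟩)
    simp only [mem_ofPred_eq] at this
    refine this.trans ?_
    rw [Real.norm_of_nonneg (pow_nonneg hy.1 n)]
    exact mul_le_mul_of_nonneg_left (pow_le_pow_left₀ hy.1 hy.2.le n) hε.le) x ⟨hx.1, le_rfl⟩
  rw [Real.norm_of_nonneg (pow_nonneg hx.1 _)]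
  simp only [h0, Complex.ofReal_zero, ne_eq, Nat.add_eq_zero_iff, one_ne_zero, and_false,
    not_false_eq_true, zero_pow, mul_zero, sub_zero] at this
  calc _ ≤ _ := this
    _ = _ := by ring

theorem isLittleO_iter {f : ℝ → ℂ} {n : ℕ∞ω} {m : ℕ} (hf : ContDiffOn ℝ n f (Icc 0 1))
    (hm : (m : ℕ∞ω) < n) (h0 : ∀ k ≤ m, iteratedDerivWithin k f (Icc 0 1) 0 = 0)
    (j : ℕ) (hj : j ≤ m) :
    (fun x : ℝ => iteratedDerivWithin (m - j) f (Icc 0 1) x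
      - iteratedDerivWithin (m + 1) f (Icc 0 1) 0 / ((j + 1).factorial : ℂ) * (x : ℂ) ^ (j + 1))
      =o[𝓝[Icc 0 1] (0 : ℝ)] fun x : ℝ => x ^ (j + 1) := by
  induction j with
  | zero =>
    have := hasDerivWithinAt_iff_isLittleO.1
      (hasDerivWithinAt_iter hf hm (left_mem_Icc.2 zero_le_one))
    simp only [h0 m le_rfl, sub_zero] at this
    simp only [Nat.sub_zero, zero_add, pow_one, Nat.factorial_one, Nat.cast_one, div_one]
    refine this.congr_left fun x => ?_
    simp [mul_comm]
  | succ j ih =>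
    have e := ih (by omega)
    have h2 : m - (j + 1) + 1 = m - j := by omega
    have := isLittleO_step (h := iteratedDerivWithin (m - (j + 1)) f (Icc 0 1)) (fun x hx => by
      have := hasDerivWithinAt_iter (k := m - (j + 1)) hf
        (lt_of_le_of_lt (by exact_mod_cast Nat.sub_le _ _) hm) hx
      rw [h2] at this
      exact this) (h0 _ (Nat.sub_le _ _)) e
    refine this.congr_left fun x => ?_
    rw [Nat.factorial_succ (j + 1)]
    congr 2
    push_cast
    rw [div_div, mul_comm]

theorem tendsto_iter {f : ℝ → ℂ} {n : ℕ∞ω} {m : ℕ} (hf : ContDiffOn ℝ n f (Icc 0 1))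
    (hm : (m : ℕ∞ω) < n) (h0 : ∀ k ≤ m, iteratedDerivWithin k f (Icc 0 1) 0 = 0)
    (j k : ℕ) (hj : k + j = m) :
    Tendsto (fun x : ℝ => iteratedDerivWithin k f (Icc 0 1) x / (x : ℂ) ^ (j + 1))
      (𝓝[>] 0)
      (𝓝 (iteratedDerivWithin (m + 1) f (Icc 0 1) 0 / ((j + 1).factorial : ℂ))) := by
  have e := isLittleO_iter hf hm h0 j (by omega)
  rw [show m - j = k by omega] at e
  have e' := (e.mono (show 𝓝[>] (0 : ℝ) ≤ 𝓝[Icc 0 1] 0 by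
    rw [nhdsWithin_Icc_eq_nhdsGE zero_lt_one]
    exact nhdsWithin_mono _ Ioi_subset_Ici_self))
  have e2 : (fun x : ℝ => iteratedDerivWithin k f (Icc 0 1) x
      - iteratedDerivWithin (m + 1) f (Icc 0 1) 0 / ((j + 1).factorial : ℂ) * (x : ℂ) ^ (j + 1))
      =o[𝓝[>] (0 : ℝ)] fun x : ℝ => (x : ℂ) ^ (j + 1) :=
    (e'.norm_right.congr_right (fun x => by simp)).of_norm_right
  have e3 := e2.tendsto_div_nhds_zero
  have e4 := e3.add_const (iteratedDerivWithin (m + 1) f (Icc 0 1) 0 / ((j + 1).factorial : ℂ))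
  rw [zero_add] at e4
  refine e4.congr' ?_
  filter_upwards [self_mem_nhdsWithin] with x hx
  have : (x : ℂ) ≠ 0 := by exact_mod_cast (ne_of_gt hx)
  field_simp
  ring

theorem eventuallyEq_pos {x : ℝ} (hx : 0 < x) {f g : ℝ → ℂ} (h : ∀ y ∈ Ioc (0 : ℝ) 1, f y = g y) :
    f =ᶠ[𝓝[Icc 0 1] x] g := by
  filter_upwards [self_mem_nhdsWithin, nhdsWithin_le_nhds (Ioi_mem_nhds hx)] with y hy hy'
  exact h y ⟨hy', hy.2⟩

theorem hasDerivWithinAt_inv_pow {x : ℝ} (hx : 0 < x) (n : ℕ) {f : ℝ → ℂ} {f' : ℂ}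
    (hf : HasDerivWithinAt f f' (Icc 0 1) x) :
    HasDerivWithinAt (fun y : ℝ => f y / (y : ℂ) ^ (n + 1))
      (f' / (x : ℂ) ^ (n + 1) - (n + 1) * f x / (x : ℂ) ^ (n + 2)) (Icc 0 1) x := by
  have h0 : (x : ℂ) ≠ 0 := by exact_mod_cast hx.ne'
  have e2 : HasDerivAt (fun y : ℝ => (y : ℂ) ^ (n + 1)) ((n + 1 : ℕ) * (x : ℂ) ^ n * 1) x :=
    HasDerivAt.pow (Complex.ofRealCLM.hasDerivAt) (n + 1)
  convert! hf.div (e2.hasDerivWithinAt) (pow_ne_zero _ h0) using 1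
  push_cast
  field_simp
  ring

theorem opD_opD {u : ℝ → ℂ} (hu : ContDiffOn ℝ 2 u (Icc 0 1)) {x : ℝ} (hx : x ∈ Ioc (0 : ℝ) 1) :
    opD (opD u) x = iteratedDerivWithin 2 u (Icc 0 1) x / (x : ℂ) ^ 2
      - iteratedDerivWithin 1 u (Icc 0 1) x / (x : ℂ) ^ 3 := by
  have hxI : x ∈ Icc (0 : ℝ) 1 := ⟨hx.1.le, hx.2⟩
  have h0 : (x : ℂ) ≠ 0 := by exact_mod_cast hx.1.ne'
  have h1 := hasDerivWithinAt_inv_pow hx.1 0 (hasDerivWithinAt_iter (k := 1) hu (by norm_num) hxI)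
  have h2 : HasDerivWithinAt (opD u) _ (Icc 0 1) x := h1.congr_of_mem (fun y hy => by
    simp only [opD, iteratedDerivWithin_one, zero_add, pow_one]
    rw [div_mul_eq_mul_div, one_mul]) hxI
  rw [opD, h2.derivWithin (uniqueDiff_I x hxI)]
  field_simp
  simp
  ring

theorem continuousOn_opD_opD {u : ℝ → ℂ} (hu : ContDiffOn ℝ 2 u (Icc 0 1)) :
    ContinuousOn (opD (opD u)) (Ioc 0 1) := by
  have hs : Ioc (0 : ℝ) 1 ⊆ Icc 0 1 := Ioc_subset_Icc_self
  have hp : ∀ n : ℕ, ∀ x ∈ Ioc (0 : ℝ) 1, (x : ℂ) ^ n ≠ 0 := fun n x hx =>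
    pow_ne_zero _ (by exact_mod_cast hx.1.ne')
  refine ContinuousOn.congr (f := fun x : ℝ => iteratedDerivWithin 2 u (Icc 0 1) x / (x : ℂ) ^ 2
      - iteratedDerivWithin 1 u (Icc 0 1) x / (x : ℂ) ^ 3) ?_ (fun x hx => opD_opD hu hx)
  refine ContinuousOn.sub (ContinuousOn.div ?_ (by fun_prop) (hp 2))
    (ContinuousOn.div ?_ (by fun_prop) (hp 3))
  · exact (hu.continuousOn_iteratedDerivWithin (by norm_num) uniqueDiff_I).mono hs
  · exact (hu.continuousOn_iteratedDerivWithin (by norm_num) uniqueDiff_I).mono hs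

theorem tendsto_opD_opD {u : ℝ → ℂ} (hu : ContDiffOn ℝ 4 u (Icc 0 1))
    (h0 : ∀ k ≤ 3, iteratedDerivWithin k u (Icc 0 1) 0 = 0) :
    ∃ c, Tendsto (opD (opD u)) (𝓝[>] 0) (𝓝 c) := by
  have h1 := tendsto_iter (m := 3) hu (by norm_num) h0 2 1 rfl
  have h2 := tendsto_iter (m := 3) hu (by norm_num) h0 1 2 rfl
  refine ⟨_, (h2.sub h1).congr' ?_⟩
  filter_upwards [Ioc_mem_nhdsGT zero_lt_one] with x hx
  rw [opD_opD (hu.of_le (by norm_num)) hx]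

theorem tendsto_opD {u : ℝ → ℂ} (hu : ContDiffOn ℝ 4 u (Icc 0 1))
    (h0 : ∀ k ≤ 3, iteratedDerivWithin k u (Icc 0 1) 0 = 0) :
    Tendsto (opD u) (𝓝[>] 0) (𝓝 0) := by
  have h1 := tendsto_iter (m := 3) hu (by norm_num) h0 2 1 rfl
  have h3 : Tendsto (fun x : ℝ => (x : ℂ) ^ 2) (𝓝[>] 0) (𝓝 0) := by
    refine Tendsto.mono_left ?_ nhdsWithin_le_nhds
    have : Continuous (fun x : ℝ => (x : ℂ) ^ 2) := by fun_prop
    simpa using this.tendsto 0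
  have h4 := h1.mul h3
  rw [mul_zero] at h4
  refine h4.congr' ?_
  filter_upwards [self_mem_nhdsWithin] with x hx
  have : (x : ℂ) ≠ 0 := by exact_mod_cast (ne_of_gt hx)
  simp only [opD, iteratedDerivWithin_one]
  field_simp

theorem exists_continuousOn_opD_opD {u : ℝ → ℂ} (hu : ContDiffOn ℝ 4 u (Icc 0 1))
    (h0 : ∀ k ≤ 3, iteratedDerivWithin k u (Icc 0 1) 0 = 0) :
    ∃ g : ℝ → ℂ, ContinuousOn g (Icc 0 1) ∧ ∀ x ∈ Ioc (0 : ℝ) 1, opD (opD u) x = g x := by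
  obtain ⟨c, hc⟩ := tendsto_opD_opD hu h0
  refine ⟨Function.update (opD (opD u)) 0 c, ?_, fun x hx => ?_⟩
  · intro x hx
    rcases eq_or_lt_of_le hx.1 with rfl | hx0
    · rw [continuousWithinAt_update_same]
      refine hc.mono_left (nhdsWithin_mono _ ?_)
      intro y hy
      exact lt_of_le_of_ne hy.1.1 (Ne.symm hy.2)
    · have h1 := continuousOn_opD_opD (hu.of_le (by norm_num)) x ⟨hx0, hx.2⟩
      have h2 : ContinuousWithinAt (opD (opD u)) (Icc 0 1) x := by
        refine h1.mono_of_mem_nhdsWithin ?_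
        filter_upwards [self_mem_nhdsWithin, nhdsWithin_le_nhds (Ioi_mem_nhds hx0)] with y hy hy'
        exact ⟨hy', hy.2⟩
      refine h2.congr_of_eventuallyEq (eventuallyEq_pos hx0 fun y hy => ?_) ?_
      · exact Function.update_of_ne hy.1.ne' _ _
      · exact Function.update_of_ne hx0.ne' _ _
  · rw [Function.update_of_ne hx.1.ne']

theorem contDiffOn_opD_opD {u : ℝ → ℂ} (hu : ContDiffOn ℝ ∞ u (Icc 0 1))
    (h0 : ∀ k ≤ 4, iteratedDerivWithin k u (Icc 0 1) 0 = 0) :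
    ContDiffOn ℝ 1 (opD (opD u)) (Icc 0 1) := by
  have hlt : ∀ k : ℕ, (k : ℕ∞ω) < ∞ := fun k => by exact_mod_cast WithTop.coe_lt_top k
  have h1 := tendsto_iter (m := 4) hu (hlt 4) h0 3 1 rfl
  have h2 := tendsto_iter (m := 4) hu (hlt 4) h0 2 2 rfl
  have h3 := tendsto_iter (m := 4) hu (hlt 4) h0 1 3 rfl
  set c := iteratedDerivWithin (4 + 1) u (Icc 0 1) 0
  have hu2 : ContDiffOn ℝ 2 u (Icc 0 1) := hu.of_le (by exact_mod_cast (hlt 2).le)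
  set d := fun k => iteratedDerivWithin k u (Icc (0 : ℝ) 1) with hd
  let G : ℝ → ℂ := fun x => d 3 x / (x : ℂ) ^ 2 - 3 * (d 2 x / (x : ℂ) ^ 3)
    + 3 * (d 1 x / (x : ℂ) ^ 4)
  have hG0 : Tendsto G (𝓝[>] 0) (𝓝 (c / 8)) := by
    have := (h3.sub (h2.const_mul 3)).add (h1.const_mul 3)
    convert! this using 2
    norm_num [Nat.factorial]
    ring
  have hder : ∀ x ∈ Ioc (0 : ℝ) 1, HasDerivWithinAt (opD (opD u)) (G x) (Icc 0 1) x := by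
    intro x hx
    have hxI : x ∈ Icc (0 : ℝ) 1 := ⟨hx.1.le, hx.2⟩
    have e1 := hasDerivWithinAt_inv_pow hx.1 2 (hasDerivWithinAt_iter (k := 1) hu (hlt 1) hxI)
    have e2 := hasDerivWithinAt_inv_pow hx.1 1 (hasDerivWithinAt_iter (k := 2) hu (hlt 2) hxI)
    have e3 := (e2.sub e1).congr_of_eventuallyEq
      (eventuallyEq_pos hx.1 (fun y hy => opD_opD hu2 hy)) (opD_opD hu2 hx)
    convert! e3 using 1
    have h0 : (x : ℂ) ≠ 0 := by exact_mod_cast hx.1.ne'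
    simp only [G, hd]
    field_simp
    push_cast
    ring
  have hder0 : HasDerivWithinAt (opD (opD u)) (c / 8) (Icc 0 1) 0 := by
    rw [hasDerivWithinAt_iff_tendsto_slope]
    have : Tendsto (slope (opD (opD u)) 0) (𝓝[>] 0) (𝓝 (c / 8)) := by
      have e := h2.sub h1
      have e' : c / ((2 + 1).factorial : ℂ) - c / ((3 + 1).factorial : ℂ) = c / 8 := by
        norm_num [Nat.factorial]
        ring
      rw [e'] at e
      refine e.congr' ?_
      filter_upwards [Ioc_mem_nhdsGT zero_lt_one] with x hx
      have h0 : (x : ℂ) ≠ 0 := by exact_mod_cast hx.1.ne'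
      rw [slope_def_module, opD_opD hu2 hx]
      simp only [opD, Complex.ofReal_zero, div_zero, zero_mul, sub_zero, Complex.real_smul,
        Complex.ofReal_inv]
      field_simp
      ring
    refine this.mono_left (nhdsWithin_mono _ ?_)
    intro y hy
    exact lt_of_le_of_ne hy.1.1 (Ne.symm hy.2)
  rw [contDiffOn_one_iff_derivWithin uniqueDiff_I]
  refine ⟨fun x hx => ?_, ?_⟩
  · rcases eq_or_lt_of_le hx.1 with rfl | hx0
    · exact hder0.differentiableWithinAt
    · exact (hder x ⟨hx0, hx.2⟩).differentiableWithinAt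
  · have hw : EqOn (derivWithin (opD (opD u)) (Icc 0 1)) (Function.update G 0 (c / 8))
        (Icc 0 1) := by
      intro x hx
      rcases eq_or_lt_of_le hx.1 with rfl | hx0
      · rw [Function.update_self, hder0.derivWithin (uniqueDiff_I _ hx)]
      · rw [Function.update_of_ne hx0.ne', (hder x ⟨hx0, hx.2⟩).derivWithin (uniqueDiff_I _ hx)]
    refine ContinuousOn.congr ?_ hw
    intro x hx
    rcases eq_or_lt_of_le hx.1 with rfl | hx0
    · rw [continuousWithinAt_update_same]
      refine hG0.mono_left (nhdsWithin_mono _ ?_)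
      intro y hy
      exact lt_of_le_of_ne hy.1.1 (Ne.symm hy.2)
    · have hx' : (x : ℂ) ≠ 0 := by exact_mod_cast hx0.ne'
      have hc : ∀ k, ContinuousWithinAt (d k) (Icc 0 1) x := fun k =>
        hu.continuousOn_iteratedDerivWithin (hlt k).le uniqueDiff_I x hx
      have hp : ∀ k : ℕ, ContinuousWithinAt (fun x : ℝ => (x : ℂ) ^ k) (Icc 0 1) x := fun k =>
        Continuous.continuousWithinAt (by fun_prop)
      have hG : ContinuousWithinAt G (Icc 0 1) x :=
        (((hc 3).div (hp 2) (pow_ne_zero _ hx')).sub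
          (((hc 2).div (hp 3) (pow_ne_zero _ hx')).const_mul 3)).add
          (((hc 1).div (hp 4) (pow_ne_zero _ hx')).const_mul 3)
      refine hG.congr_of_eventuallyEq (eventuallyEq_pos hx0 fun y hy => ?_) ?_
      · exact Function.update_of_ne hy.1.ne' _ _
      · exact Function.update_of_ne hx0.ne' _ _



/-- Membership in the space of pairs `u = (u₁, u₂) ∈ C⁴[0,1] × C¹[0,1]` with
`u₁⁽ᵏ⁾(0) = u₂(0) = 0` for `k = 0, 1, 2, 3`. A function on `[0,1]` is represented by its extension by
zero to the real line, so that two representatives agree if and only if they agree on `[0,1]`;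
regularity and derivatives are those relative to the closed interval `[0,1]`. -/
def IsPreEnergy (u : (ℝ → ℂ) × (ℝ → ℂ)) : Prop :=
  (∀ ρ ∉ Icc (0 : ℝ) 1, u.1 ρ = 0 ∧ u.2 ρ = 0) ∧
  ContDiffOn ℝ 4 u.1 (Icc 0 1) ∧ ContDiffOn ℝ 1 u.2 (Icc 0 1) ∧
  (∀ k ≤ 3, iteratedDerivWithin k u.1 (Icc 0 1) 0 = 0) ∧ u.2 0 = 0

theorem zero_mem_I : (0 : ℝ) ∈ Icc (0 : ℝ) 1 := left_mem_Icc.2 zero_le_one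

theorem iter_add {f g : ℝ → ℂ} {n : ℕ} (hf : ContDiffOn ℝ n f (Icc 0 1))
    (hg : ContDiffOn ℝ n g (Icc 0 1)) {x : ℝ} (hx : x ∈ Icc (0 : ℝ) 1) :
    iteratedDerivWithin n (f + g) (Icc 0 1) x
      = iteratedDerivWithin n f (Icc 0 1) x + iteratedDerivWithin n g (Icc 0 1) x :=
  iteratedDerivWithin_add hx uniqueDiff_I (hf x hx) (hg x hx)

theorem iter_smul (c : ℂ) (f : ℝ → ℂ) (n : ℕ) (x : ℝ) :
    iteratedDerivWithin n (c • f) (Icc 0 1) x = c * iteratedDerivWithin n f (Icc 0 1) x :=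
  iteratedDerivWithin_const_smul_field c f

/-- These pairs form a complex vector space. -/
def preEnergySubmodule : Submodule ℂ ((ℝ → ℂ) × (ℝ → ℂ)) where
  carrier := {u | IsPreEnergy u}
  zero_mem' := by
    refine ⟨fun _ _ => ⟨rfl, rfl⟩, contDiffOn_const, contDiffOn_const, fun k _ => ?_, rfl⟩
    change iteratedDerivWithin k (0 : ℝ → ℂ) (Icc 0 1) 0 = 0
    rw [iteratedDerivWithin_const_zero]
  add_mem' := by
    rintro u v ⟨a1, a2, a3, a4, a5⟩ ⟨b1, b2, b3, b4, b5⟩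
    refine ⟨fun x hx => ⟨?_, ?_⟩, a2.add b2, a3.add b3, fun k hk => ?_, ?_⟩
    · simp [(a1 x hx).1, (b1 x hx).1]
    · simp [(a1 x hx).2, (b1 x hx).2]
    · have hk4 : (k : ℕ∞ω) ≤ 4 := by exact_mod_cast (by omega : k ≤ 4)
      rw [Prod.fst_add, iter_add (a2.of_le hk4) (b2.of_le hk4) zero_mem_I, a4 k hk, b4 k hk,
        add_zero]
    · simp [a5, b5]
  smul_mem' := by
    rintro c u ⟨a1, a2, a3, a4, a5⟩
    refine ⟨fun x hx => ⟨?_, ?_⟩, contDiffOn_const.smul a2, contDiffOn_const.smul a3,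
      fun k hk => ?_, ?_⟩
    · simp [(a1 x hx).1]
    · simp [(a1 x hx).2]
    · rw [Prod.smul_fst, iter_smul, a4 k hk, mul_zero]
    · simp [a5]

/-- The space of pairs as a type of its own; it carries the topology of the inner product below, not
that of pointwise convergence. -/
def PreEnergySpace : Type := preEnergySubmodule

namespace PreEnergySpace

instance : AddCommGroup PreEnergySpace := inferInstanceAs (AddCommGroup preEnergySubmodule)

instance : Module ℂ PreEnergySpace := inferInstanceAs (Module ℂ preEnergySubmodule)

/-- The first component `u₁`. -/
def fst (u : PreEnergySpace) : ℝ → ℂ := u.1.1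

/-- The second component `u₂`. -/
def snd (u : PreEnergySpace) : ℝ → ℂ := u.1.2

/-- The element with given components. -/
def mk (f g : ℝ → ℂ) (h : IsPreEnergy (f, g)) : PreEnergySpace := ⟨(f, g), h⟩

theorem prop (u : PreEnergySpace) : IsPreEnergy (u.fst, u.snd) := u.2

@[ext] theorem ext {u v : PreEnergySpace} (h1 : ∀ x ∈ Icc (0 : ℝ) 1, u.fst x = v.fst x)
    (h2 : ∀ x ∈ Icc (0 : ℝ) 1, u.snd x = v.snd x) : u = v := by
  refine Subtype.ext (Prod.ext ?_ ?_)
  · funext x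
    by_cases hx : x ∈ Icc (0 : ℝ) 1
    · exact h1 x hx
    · exact ((u.prop.1 x hx).1).trans ((v.prop.1 x hx).1).symm
  · funext x
    by_cases hx : x ∈ Icc (0 : ℝ) 1
    · exact h2 x hx
    · exact ((u.prop.1 x hx).2).trans ((v.prop.1 x hx).2).symm

@[simp] theorem fst_add (u v : PreEnergySpace) : (u + v).fst = u.fst + v.fst := rfl
@[simp] theorem snd_add (u v : PreEnergySpace) : (u + v).snd = u.snd + v.snd := rfl
@[simp] theorem fst_smul (c : ℂ) (u : PreEnergySpace) : (c • u).fst = c • u.fst := rfl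
@[simp] theorem snd_smul (c : ℂ) (u : PreEnergySpace) : (c • u).snd = c • u.snd := rfl
@[simp] theorem fst_zero : (0 : PreEnergySpace).fst = 0 := rfl
@[simp] theorem snd_zero : (0 : PreEnergySpace).snd = 0 := rfl

/-- The sesquilinear form
`(u|v) = ∫₀¹ D²u₁ conj(D²v₁) dρ + ∫₀¹ u₂' conj(v₂') dρ`, linear in the first argument. -/
def form (u v : PreEnergySpace) : ℂ :=
  (∫ ρ in (0 : ℝ)..1, opD (opD u.fst) ρ * starRingEnd ℂ (opD (opD v.fst) ρ)) +
  ∫ ρ in (0 : ℝ)..1, derivWithin u.snd (Icc 0 1) ρ * starRingEnd ℂ (derivWithin v.snd (Icc 0 1) ρ)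

theorem contDiff_fst (u : PreEnergySpace) : ContDiffOn ℝ 4 u.fst (Icc 0 1) := u.prop.2.1

theorem contDiff_snd (u : PreEnergySpace) : ContDiffOn ℝ 1 u.snd (Icc 0 1) := u.prop.2.2.1

theorem continuousOn_dsnd (u : PreEnergySpace) :
    ContinuousOn (derivWithin u.snd (Icc 0 1)) (Icc 0 1) :=
  u.contDiff_snd.continuousOn_derivWithin uniqueDiff_I le_rfl

theorem differentiableOn_snd (u : PreEnergySpace) : DifferentiableOn ℝ u.snd (Icc 0 1) :=
  u.contDiff_snd.differentiableOn one_ne_zero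

theorem opD_opD_add (u v : PreEnergySpace) {x : ℝ} (hx : x ∈ Ioc (0 : ℝ) 1) :
    opD (opD (u + v).fst) x = opD (opD u.fst) x + opD (opD v.fst) x := by
  have hxI : x ∈ Icc (0 : ℝ) 1 := Ioc_subset_Icc_self hx
  have h := fun w : PreEnergySpace => opD_opD (w.contDiff_fst.of_le (by norm_num)) hx
  rw [h, h, h, fst_add, iter_add (u.contDiff_fst.of_le (by norm_num))
    (v.contDiff_fst.of_le (by norm_num)) hxI, iter_add (u.contDiff_fst.of_le (by norm_num))
    (v.contDiff_fst.of_le (by norm_num)) hxI]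
  ring

theorem opD_opD_smul (c : ℂ) (u : PreEnergySpace) {x : ℝ} (hx : x ∈ Ioc (0 : ℝ) 1) :
    opD (opD (c • u).fst) x = c * opD (opD u.fst) x := by
  have h := fun w : PreEnergySpace => opD_opD (w.contDiff_fst.of_le (by norm_num)) hx
  rw [h, h, fst_smul, iter_smul, iter_smul]
  ring

theorem dsnd_add (u v : PreEnergySpace) {x : ℝ} (hx : x ∈ Icc (0 : ℝ) 1) :
    derivWithin (u + v).snd (Icc 0 1) x
      = derivWithin u.snd (Icc 0 1) x + derivWithin v.snd (Icc 0 1) x :=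
  derivWithin_add (u.differentiableOn_snd x hx) (v.differentiableOn_snd x hx)

theorem dsnd_smul (c : ℂ) (u : PreEnergySpace) {x : ℝ} (hx : x ∈ Icc (0 : ℝ) 1) :
    derivWithin (c • u).snd (Icc 0 1) x = c * derivWithin u.snd (Icc 0 1) x :=
  derivWithin_const_smul c (u.differentiableOn_snd x hx)

theorem exists_rep (u : PreEnergySpace) :
    ∃ g : ℝ → ℂ, ContinuousOn g (Icc 0 1) ∧ ∀ x ∈ Ioc (0 : ℝ) 1, opD (opD u.fst) x = g x :=
  exists_continuousOn_opD_opD u.contDiff_fst u.prop.2.2.2.1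

theorem integrable_opD_opD (u v : PreEnergySpace) : IntervalIntegrable
    (fun ρ => opD (opD u.fst) ρ * starRingEnd ℂ (opD (opD v.fst) ρ)) volume 0 1 := by
  obtain ⟨g, hg, hgu⟩ := u.exists_rep
  obtain ⟨k, hk, hkv⟩ := v.exists_rep
  have h1 : IntervalIntegrable (fun ρ => g ρ * starRingEnd ℂ (k ρ)) volume 0 1 := by
    refine ContinuousOn.intervalIntegrable_of_Icc zero_le_one (hg.mul ?_)
    exact Complex.continuous_conj.comp_continuousOn hk
  refine h1.congr ?_
  rw [uIoc_of_le zero_le_one]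
  intro x hx
  simp only [hgu x hx, hkv x hx]

theorem integrable_dsnd (u v : PreEnergySpace) : IntervalIntegrable
    (fun ρ => derivWithin u.snd (Icc 0 1) ρ * starRingEnd ℂ (derivWithin v.snd (Icc 0 1) ρ))
    volume 0 1 :=
  ContinuousOn.intervalIntegrable_of_Icc zero_le_one (u.continuousOn_dsnd.mul
    (Complex.continuous_conj.comp_continuousOn v.continuousOn_dsnd))

theorem integral_congr' {E : Type*} [NormedAddCommGroup E] [NormedSpace ℝ E] {f g : ℝ → E} (h : ∀ x ∈ Ioc (0 : ℝ) 1, f x = g x) :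
    ∫ x in (0 : ℝ)..1, f x = ∫ x in (0 : ℝ)..1, g x := by
  rw [intervalIntegral.integral_of_le zero_le_one, intervalIntegral.integral_of_le zero_le_one]
  exact setIntegral_congr_fun measurableSet_Ioc h

theorem form_add_left (u v w : PreEnergySpace) : form (u + v) w = form u w + form v w := by
  have h1 := integral_congr' (f := fun ρ =>
      opD (opD (u + v).fst) ρ * starRingEnd ℂ (opD (opD w.fst) ρ)) (g := fun ρ =>
      opD (opD u.fst) ρ * starRingEnd ℂ (opD (opD w.fst) ρ) +
      opD (opD v.fst) ρ * starRingEnd ℂ (opD (opD w.fst) ρ)) (fun x hx => by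
    simp only [opD_opD_add u v hx, add_mul])
  have h2 := integral_congr' (f := fun ρ => derivWithin (u + v).snd (Icc 0 1) ρ *
      starRingEnd ℂ (derivWithin w.snd (Icc 0 1) ρ)) (g := fun ρ =>
      derivWithin u.snd (Icc 0 1) ρ * starRingEnd ℂ (derivWithin w.snd (Icc 0 1) ρ) +
      derivWithin v.snd (Icc 0 1) ρ * starRingEnd ℂ (derivWithin w.snd (Icc 0 1) ρ))
    (fun x hx => by
    simp only [dsnd_add u v (Ioc_subset_Icc_self hx), add_mul])
  rw [form, h1, h2, intervalIntegral.integral_add (integrable_opD_opD u w)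
    (integrable_opD_opD v w), intervalIntegral.integral_add (integrable_dsnd u w)
    (integrable_dsnd v w), form, form]
  ring

theorem form_smul_left (c : ℂ) (u w : PreEnergySpace) : form (c • u) w = c * form u w := by
  have h1 := integral_congr' (f := fun ρ =>
      opD (opD (c • u).fst) ρ * starRingEnd ℂ (opD (opD w.fst) ρ)) (g := fun ρ =>
      c * (opD (opD u.fst) ρ * starRingEnd ℂ (opD (opD w.fst) ρ))) (fun x hx => by
    simp only [opD_opD_smul c u hx, mul_assoc])
  have h2 := integral_congr' (f := fun ρ => derivWithin (c • u).snd (Icc 0 1) ρ *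
      starRingEnd ℂ (derivWithin w.snd (Icc 0 1) ρ)) (g := fun ρ =>
      c * (derivWithin u.snd (Icc 0 1) ρ * starRingEnd ℂ (derivWithin w.snd (Icc 0 1) ρ)))
    (fun x hx => by
    simp only [dsnd_smul c u (Ioc_subset_Icc_self hx), mul_assoc])
  rw [form, h1, h2, intervalIntegral.integral_const_mul, intervalIntegral.integral_const_mul, form]
  ring

theorem conj_form (u v : PreEnergySpace) : starRingEnd ℂ (form u v) = form v u := by
  have h : ∀ f : ℝ → ℂ, starRingEnd ℂ (∫ x in (0 : ℝ)..1, f x)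
      = ∫ x in (0 : ℝ)..1, starRingEnd ℂ (f x) := fun f => by
    rw [intervalIntegral.integral_of_le zero_le_one, intervalIntegral.integral_of_le zero_le_one]
    exact integral_conj.symm
  simp only [form, map_add, h, map_mul, Complex.conj_conj, mul_comm]

theorem integral_normSq (f : ℝ → ℂ) : ∫ x in (0 : ℝ)..1, f x * starRingEnd ℂ (f x)
    = ((∫ x in (0 : ℝ)..1, ‖f x‖ ^ 2 : ℝ) : ℂ) := by
  rw [← intervalIntegral.integral_ofReal]
  congr 1
  funext x
  rw [Complex.mul_conj, Complex.normSq_eq_norm_sq]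

theorem form_self (u : PreEnergySpace) : form u u =
    (((∫ ρ in (0 : ℝ)..1, ‖opD (opD u.fst) ρ‖ ^ 2) +
      ∫ ρ in (0 : ℝ)..1, ‖derivWithin u.snd (Icc 0 1) ρ‖ ^ 2 : ℝ) : ℂ) := by
  rw [form, integral_normSq, integral_normSq]
  push_cast
  rfl

theorem integral_sq_nonneg (f : ℝ → ℂ) : 0 ≤ ∫ x in (0 : ℝ)..1, ‖f x‖ ^ 2 :=
  intervalIntegral.integral_nonneg zero_le_one fun _ _ => by positivity

theorem eq_zero_of_integral {f : ℝ → ℂ} (hf : ContinuousOn f (Icc 0 1))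
    (h : ∫ x in (0 : ℝ)..1, ‖f x‖ ^ 2 = 0) : ∀ x ∈ Icc (0 : ℝ) 1, f x = 0 := by
  intro x hx
  by_contra hne
  refine (intervalIntegral.integral_pos (f := fun x => ‖f x‖ ^ 2) zero_lt_one (hf.norm.pow 2)
    (fun _ _ => by positivity) ⟨x, hx, ?_⟩).ne' h
  have := norm_pos_iff.2 hne
  positivity

theorem eq_zero_of_form_self (u : PreEnergySpace) (h : form u u = 0) : u = 0 := by
  rw [form_self, Complex.ofReal_eq_zero] at h
  have h1 : ∫ ρ in (0 : ℝ)..1, ‖opD (opD u.fst) ρ‖ ^ 2 = 0 := by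
    linarith [integral_sq_nonneg (opD (opD u.fst)), integral_sq_nonneg (derivWithin u.snd (Icc 0 1))]
  have h2 : ∫ ρ in (0 : ℝ)..1, ‖derivWithin u.snd (Icc 0 1) ρ‖ ^ 2 = 0 := by
    linarith [integral_sq_nonneg (opD (opD u.fst)), integral_sq_nonneg (derivWithin u.snd (Icc 0 1))]
  have k2 := eq_zero_of_integral u.continuousOn_dsnd h2
  have const : ∀ f : ℝ → ℂ, DifferentiableOn ℝ f (Icc 0 1) → f 0 = 0 →
      (∀ x ∈ Icc (0 : ℝ) 1, derivWithin f (Icc 0 1) x = 0) → ∀ x ∈ Icc (0 : ℝ) 1, f x = 0 :=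
    fun f hf h0 hd x hx =>
      (constant_of_derivWithin_zero hf (fun y hy => hd y (Ico_subset_Icc_self hy)) x hx).trans h0
  obtain ⟨g, hg, hgu⟩ := u.exists_rep
  have h1' : ∫ ρ in (0 : ℝ)..1, ‖g ρ‖ ^ 2 = 0 := by
    refine Eq.trans (integral_congr' fun x hx => ?_) h1
    simp only [hgu x hx]
  have k1 : ∀ x ∈ Ioc (0 : ℝ) 1, opD (opD u.fst) x = 0 := fun x hx => by
    rw [hgu x hx, eq_zero_of_integral hg h1' x (Ioc_subset_Icc_self hx)]
  have hdiff : ∀ x ∈ Ioc (0 : ℝ) 1, HasDerivWithinAt (opD u.fst) 0 (Ioc 0 1) x := by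
    intro x hx
    have hx' : (x : ℂ) ≠ 0 := by exact_mod_cast hx.1.ne'
    have hxI : x ∈ Icc (0 : ℝ) 1 := Ioc_subset_Icc_self hx
    have e := k1 x hx
    rw [opD] at e
    have e0 : derivWithin (opD u.fst) (Icc 0 1) x = 0 := by
      rcases mul_eq_zero.1 e with e | e
      · exact absurd e (one_div_ne_zero hx')
      · exact e
    have e1 := hasDerivWithinAt_inv_pow hx.1 0
      (hasDerivWithinAt_iter (k := 1) u.contDiff_fst (by norm_num) hxI)
    have e2 : HasDerivWithinAt (opD u.fst) _ (Icc 0 1) x := e1.congr_of_mem (fun y hy => by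
      simp only [opD, iteratedDerivWithin_one, zero_add, pow_one]
      rw [div_mul_eq_mul_div, one_mul]) hxI
    have e3 := e2.differentiableWithinAt.hasDerivWithinAt
    rw [e0] at e3
    exact e3.mono Ioc_subset_Icc_self
  have hconst : ∀ x ∈ Ioc (0 : ℝ) 1, opD u.fst x = opD u.fst 1 := by
    intro x hx
    have := (convex_Ioc (0 : ℝ) 1).norm_image_sub_le_of_norm_hasDerivWithin_le (C := 0) hdiff
      (fun y _ => by simp) (right_mem_Ioc.2 zero_lt_one) hx
    rw [zero_mul] at this
    exact sub_eq_zero.1 (norm_le_zero_iff.1 this)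
  have hlim := tendsto_opD u.contDiff_fst u.prop.2.2.2.1
  have hone : opD u.fst 1 = 0 := by
    refine tendsto_nhds_unique (tendsto_const_nhds.congr' ?_) hlim
    filter_upwards [Ioc_mem_nhdsGT zero_lt_one] with x hx
    exact (hconst x hx).symm
  refine PreEnergySpace.ext ?_ ?_
  · refine const u.fst (u.contDiff_fst.differentiableOn (by norm_num)) (u.prop.2.2.2.1 0 (by norm_num)) ?_
    intro x hx
    rcases eq_or_lt_of_le hx.1 with rfl | hx0
    · rw [← iteratedDerivWithin_one]
      exact u.prop.2.2.2.1 1 (by norm_num)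
    · have hx' : (x : ℂ) ≠ 0 := by exact_mod_cast hx0.ne'
      have e := hconst x ⟨hx0, hx.2⟩
      rw [hone, opD] at e
      rcases mul_eq_zero.1 e with e | e
      · exact absurd e (one_div_ne_zero hx')
      · exact e
  · exact const u.snd u.differentiableOn_snd u.prop.2.2.2.2 k2

/-- The form is an inner product. Mathlib's inner products are linear in the second argument, so
`inner ℂ u v` is `(v|u)`. -/
@[reducible] def innerCore : InnerProductSpace.Core ℂ PreEnergySpace where
  inner u v := form v u
  conj_inner_symm u v := conj_form u v
  re_inner_nonneg u := by
    change 0 ≤ (form u u).re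
    rw [form_self, Complex.ofReal_re]
    exact add_nonneg (integral_sq_nonneg _) (integral_sq_nonneg _)
  add_left u v w := by
    change form w (u + v) = form w u + form w v
    rw [← conj_form, form_add_left, map_add, conj_form, conj_form]
  smul_left u v c := by
    change form v (c • u) = starRingEnd ℂ c * form v u
    rw [← conj_form, form_smul_left, map_mul, conj_form]
  definite u h := eq_zero_of_form_self u h

instance : NormedAddCommGroup PreEnergySpace :=
  innerCore.toNormedAddCommGroup

instance : InnerProductSpace ℂ PreEnergySpace :=
  InnerProductSpace.ofCore innerCore.toCore

theorem inner_eq_form (u v : PreEnergySpace) : inner ℂ v u = form u v := rfl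

end PreEnergySpace

/-- The higher energy Hilbert space: the completion of the pre-Hilbert space. -/
abbrev EnergySpace : Type := UniformSpace.Completion PreEnergySpace

/-- First component of the free operator: `-ρ u₁' + 2 u₁ + ρ² u₂ - 3 K u₂`. -/
def freeFst (u : PreEnergySpace) (ρ : ℝ) : ℂ :=
  -(ρ : ℂ) * derivWithin u.fst (Icc 0 1) ρ + 2 * u.fst ρ + (ρ : ℂ) ^ 2 * u.snd ρ
    - 3 * opK u.snd ρ

/-- Second component of the free operator: `D² u₁ - ρ u₂' - u₂`. -/
def freeSnd (u : PreEnergySpace) (ρ : ℝ) : ℂ :=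
  opD (opD u.fst) ρ - (ρ : ℂ) * derivWithin u.snd (Icc 0 1) ρ - u.snd ρ

/-- Membership in the domain of the free operator: both components are in `C^∞[0,1]`, and
`u₁⁽ᵏ⁾(0) = u₂(0) = 0` for `k = 0, 1, 2, 3, 4`. -/
def IsSmoothData (u : PreEnergySpace) : Prop :=
  ContDiffOn ℝ ∞ u.fst (Icc 0 1) ∧ ContDiffOn ℝ ∞ u.snd (Icc 0 1) ∧
  (∀ k ≤ 4, iteratedDerivWithin k u.fst (Icc 0 1) 0 = 0) ∧ u.snd 0 = 0

theorem lt_infty (k : ℕ) : (k : ℕ∞ω) < ∞ := by exact_mod_cast WithTop.coe_lt_top k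

/-- The domain of the free operator, as a subspace of the pre-Hilbert space. -/
def freeDomain : Submodule ℂ PreEnergySpace where
  carrier := {u | IsSmoothData u}
  zero_mem' := by
    refine ⟨contDiffOn_const, contDiffOn_const, fun k _ => ?_, rfl⟩
    change iteratedDerivWithin k (0 : ℝ → ℂ) (Icc 0 1) 0 = 0
    rw [iteratedDerivWithin_const_zero]
  add_mem' := by
    rintro u v ⟨a1, a2, a3, a4⟩ ⟨b1, b2, b3, b4⟩
    refine ⟨a1.add b1, a2.add b2, fun k hk => ?_, ?_⟩
    · rw [PreEnergySpace.fst_add, iter_add (a1.of_le (lt_infty k).le) (b1.of_le (lt_infty k).le)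
        zero_mem_I, a3 k hk, b3 k hk, add_zero]
    · simp [a4, b4]
  smul_mem' := by
    rintro c u ⟨a1, a2, a3, a4⟩
    refine ⟨contDiffOn_const.smul a1, contDiffOn_const.smul a2, fun k hk => ?_, ?_⟩
    · rw [PreEnergySpace.fst_smul, iter_smul, a3 k hk, mul_zero]
    · simp [a4]

theorem hasDerivWithinAt_opK {f : ℝ → ℂ} (hf : ContinuousOn f (Icc 0 1)) {x : ℝ}
    (hx : x ∈ Icc (0 : ℝ) 1) : HasDerivWithinAt (opK f) ((x : ℂ) * f x) (Icc 0 1) x := by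
  have hg : Continuous (IccExtend zero_le_one ((Icc (0 : ℝ) 1).domRestrict f)) :=
    (continuousOn_iff_continuous_domRestrict.1 hf).Icc_extend'
  set g := IccExtend zero_le_one ((Icc (0 : ℝ) 1).domRestrict f)
  have hgf : ∀ y ∈ Icc (0 : ℝ) 1, g y = f y := fun y hy => IccExtend_of_mem _ _ hy
  have hc : Continuous fun y : ℝ => (y : ℂ) * g y := by fun_prop
  have h1 := (hc.integral_hasStrictDerivAt 0 x).hasDerivAt.hasDerivWithinAt (s := Icc 0 1)
  rw [hgf x hx] at h1
  refine h1.congr_of_mem (fun y hy => ?_) hx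
  refine intervalIntegral.integral_congr fun s hs => ?_
  rw [uIcc_of_le hy.1] at hs
  simp only [hgf s ⟨hs.1, hs.2.trans hy.2⟩]

theorem contDiffOn_ofReal (n : ℕ∞ω) : ContDiffOn ℝ n (fun x : ℝ => (x : ℂ)) (Icc 0 1) :=
  Complex.ofRealCLM.contDiff.contDiffOn

theorem contDiffOn_opK {f : ℝ → ℂ} (hf : ContDiffOn ℝ ∞ f (Icc 0 1)) :
    ContDiffOn ℝ ∞ (opK f) (Icc 0 1) := by
  have h := fun x hx => hasDerivWithinAt_opK hf.continuousOn (x := x) hx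
  rw [contDiffOn_infty_iff_derivWithin uniqueDiff_I]
  refine ⟨fun x hx => (h x hx).differentiableWithinAt, ?_⟩
  exact ((contDiffOn_ofReal ∞).mul hf).congr fun x hx => (h x hx).derivWithin (uniqueDiff_I x hx)

theorem contDiffOn_freeFst {u : PreEnergySpace} (hu : IsSmoothData u) :
    ContDiffOn ℝ ∞ (freeFst u) (Icc 0 1) := by
  have hx := contDiffOn_ofReal ∞
  have hd : ContDiffOn ℝ ∞ (derivWithin u.fst (Icc 0 1)) (Icc 0 1) :=
    ((contDiffOn_infty_iff_derivWithin uniqueDiff_I).1 hu.1).2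
  exact (((hx.neg.mul hd).add (contDiffOn_const.mul hu.1)).add ((hx.pow 2).mul hu.2.1)).sub
    (contDiffOn_const.mul (contDiffOn_opK hu.2.1))

theorem iter_eq_of_chain {F : ℕ → ℝ → ℂ} {n : ℕ}
    (h : ∀ k < n, ∀ x ∈ Icc (0 : ℝ) 1, HasDerivWithinAt (F k) (F (k + 1) x) (Icc 0 1) x) :
    ∀ k ≤ n, ∀ x ∈ Icc (0 : ℝ) 1, iteratedDerivWithin k (F 0) (Icc 0 1) x = F k x := by
  intro k
  induction k with
  | zero => intro _ x _; simp
  | succ k ih =>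
    intro hk x hx
    rw [iteratedDerivWithin_succ,
      derivWithin_congr (fun y hy => ih (by omega) y hy) (ih (by omega) x hx)]
    exact (h k (by omega) x hx).derivWithin (uniqueDiff_I x hx)

theorem iter_freeFst {u : PreEnergySpace} (hu : IsSmoothData u) :
    ∀ k ≤ 3, iteratedDerivWithin k (freeFst u) (Icc 0 1) 0 = 0 := by
  set d := fun k => iteratedDerivWithin k u.fst (Icc (0 : ℝ) 1) with hd
  set e := fun k => iteratedDerivWithin k u.snd (Icc (0 : ℝ) 1) with he
  have h1 : ∀ k, ∀ x ∈ Icc (0 : ℝ) 1, HasDerivWithinAt (d k) (d (k + 1) x) (Icc 0 1) x :=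
    fun k x hx => hasDerivWithinAt_iter hu.1 (lt_infty k) hx
  have h2 : ∀ k, ∀ x ∈ Icc (0 : ℝ) 1, HasDerivWithinAt (e k) (e (k + 1) x) (Icc 0 1) x :=
    fun k x hx => hasDerivWithinAt_iter hu.2.1 (lt_infty k) hx
  have hX : ∀ x, HasDerivWithinAt (fun x : ℝ => (x : ℂ)) 1 (Icc 0 1) x := fun x =>
    Complex.ofRealCLM.hasDerivAt.hasDerivWithinAt
  have hX2 : ∀ x : ℝ, HasDerivWithinAt (fun x : ℝ => (x : ℂ) ^ 2) (2 * (x : ℂ)) (Icc 0 1) x :=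
    fun x => HasDerivWithinAt.congr_deriv ((hX x).pow 2) (by norm_num)
  let F : ℕ → ℝ → ℂ
    | 0 => fun x => -(x : ℂ) * d 1 x + 2 * d 0 x + (x : ℂ) ^ 2 * e 0 x - 3 * opK u.snd x
    | 1 => fun x => -(x : ℂ) * d 2 x + d 1 x + (x : ℂ) ^ 2 * e 1 x - (x : ℂ) * e 0 x
    | 2 => fun x => -(x : ℂ) * d 3 x + (x : ℂ) ^ 2 * e 2 x + (x : ℂ) * e 1 x - e 0 x
    | _ => fun x => -(x : ℂ) * d 4 x - d 3 x + (x : ℂ) ^ 2 * e 3 x + 3 * (x : ℂ) * e 2 x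
  have hF0 : F 0 = freeFst u := by
    funext x
    simp only [F, freeFst, hd, he, iteratedDerivWithin_one, iteratedDerivWithin_zero]
  have hch : ∀ k < 3, ∀ x ∈ Icc (0 : ℝ) 1,
      HasDerivWithinAt (F k) (F (k + 1) x) (Icc 0 1) x := by
    intro k hk x hx
    have hK := hasDerivWithinAt_opK hu.2.1.continuousOn hx
    have he0 : e 0 x = u.snd x := by simp [he]
    interval_cases k
    · refine HasDerivWithinAt.congr_deriv (((((hX x).neg.mul (h1 1 x hx)).add
        ((h1 0 x hx).const_mul 2)).add ((hX2 x).mul (h2 0 x hx))).sub (hK.const_mul 3)) ?_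
      simp only [F, ← he0, Pi.neg_apply]
      ring
    · refine HasDerivWithinAt.congr_deriv (((((hX x).neg.mul (h1 2 x hx)).add
        (h1 1 x hx)).add ((hX2 x).mul (h2 1 x hx))).sub ((hX x).mul (h2 0 x hx))) ?_
      simp only [F, Pi.neg_apply]
      ring
    · refine HasDerivWithinAt.congr_deriv (((((hX x).neg.mul (h1 3 x hx)).add
        ((hX2 x).mul (h2 2 x hx))).add ((hX x).mul (h2 1 x hx))).sub (h2 0 x hx)) ?_
      simp only [F, Pi.neg_apply]
      ring
  intro k hk
  rw [← hF0, iter_eq_of_chain hch k hk 0 zero_mem_I]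
  have z : ∀ j ≤ 4, d j 0 = 0 := hu.2.2.1
  have ze : e 0 0 = 0 := by simpa [he] using hu.2.2.2
  have zK : opK u.snd 0 = 0 := by simp [opK]
  interval_cases k
  · simp [F, z 0 (by norm_num), zK]
  · simp [F, z 1 (by norm_num)]
  · simp [F, ze]
  · simp [F, z 3 (by norm_num)]

theorem contDiffOn_freeSnd {u : PreEnergySpace} (hu : IsSmoothData u) :
    ContDiffOn ℝ 1 (freeSnd u) (Icc 0 1) := by
  have hx := contDiffOn_ofReal 1
  have hd : ContDiffOn ℝ ∞ (derivWithin u.snd (Icc 0 1)) (Icc 0 1) :=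
    ((contDiffOn_infty_iff_derivWithin uniqueDiff_I).1 hu.2.1).2
  have h1 : (1 : ℕ∞ω) ≤ ∞ := by exact_mod_cast (lt_infty 1).le
  exact ((contDiffOn_opD_opD hu.1 hu.2.2.1).sub (hx.mul (hd.of_le h1))).sub (hu.2.1.of_le h1)

theorem isPreEnergy_free {u : PreEnergySpace} (hu : IsSmoothData u) :
    IsPreEnergy ((Icc 0 1).indicator (freeFst u), (Icc 0 1).indicator (freeSnd u)) := by
  have e1 : EqOn ((Icc 0 1).indicator (freeFst u)) (freeFst u) (Icc 0 1) := eqOn_indicator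
  have e2 : EqOn ((Icc 0 1).indicator (freeSnd u)) (freeSnd u) (Icc 0 1) := eqOn_indicator
  refine ⟨fun x hx => ⟨indicator_of_notMem hx _, indicator_of_notMem hx _⟩,
    ((contDiffOn_freeFst hu).of_le (by exact_mod_cast (lt_infty 4).le)).congr e1,
    (contDiffOn_freeSnd hu).congr e2, fun k hk => ?_, ?_⟩
  · rw [iteratedDerivWithin_congr e1 zero_mem_I, iter_freeFst hu k hk]
  · change (Icc (0 : ℝ) 1).indicator (freeSnd u) 0 = 0
    rw [e2 zero_mem_I]
    simp [freeSnd, opD, hu.2.2.2]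

theorem opD_zero (f : ℝ → ℂ) : opD f 0 = 0 := by simp [opD]

theorem opK_add {f g : ℝ → ℂ} (hf : ContinuousOn f (Icc 0 1)) (hg : ContinuousOn g (Icc 0 1))
    {x : ℝ} (hx : x ∈ Icc (0 : ℝ) 1) : opK (f + g) x = opK f x + opK g x := by
  have h : ∀ k : ℝ → ℂ, ContinuousOn k (Icc 0 1) →
      IntervalIntegrable (fun s : ℝ => (s : ℂ) * k s) volume 0 x := fun k hk =>
    ContinuousOn.intervalIntegrable_of_Icc hx.1 (ContinuousOn.mul (by fun_prop)
      (hk.mono (Icc_subset_Icc_right hx.2)))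
  rw [opK, opK, opK, ← intervalIntegral.integral_add (h f hf) (h g hg)]
  simp only [Pi.add_apply, mul_add]

theorem opK_smul (c : ℂ) (f : ℝ → ℂ) (x : ℝ) : opK (c • f) x = c * opK f x := by
  rw [opK, opK, ← intervalIntegral.integral_const_mul]
  simp only [Pi.smul_apply, smul_eq_mul, mul_left_comm]

/-- The free operator, which maps its domain into the pre-Hilbert space. -/
def freePre : freeDomain →ₗ[ℂ] PreEnergySpace where
  toFun u := PreEnergySpace.mk ((Icc 0 1).indicator (freeFst u.1))
    ((Icc 0 1).indicator (freeSnd u.1)) (isPreEnergy_free u.2)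
  map_add' u v := by
    refine PreEnergySpace.ext (fun x hx => ?_) (fun x hx => ?_)
    · change (Icc 0 1).indicator (freeFst (u.1 + v.1)) x
        = (Icc 0 1).indicator (freeFst u.1) x + (Icc 0 1).indicator (freeFst v.1) x
      simp only [indicator_of_mem hx, freeFst, PreEnergySpace.fst_add, PreEnergySpace.snd_add]
      rw [opK_add u.1.contDiff_snd.continuousOn v.1.contDiff_snd.continuousOn hx,
        derivWithin_add (u.1.contDiff_fst.differentiableOn (by norm_num) x hx)
          (v.1.contDiff_fst.differentiableOn (by norm_num) x hx)]
      simp only [Pi.add_apply]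
      ring
    · change (Icc 0 1).indicator (freeSnd (u.1 + v.1)) x
        = (Icc 0 1).indicator (freeSnd u.1) x + (Icc 0 1).indicator (freeSnd v.1) x
      have h : opD (opD (u.1 + v.1).fst) x = opD (opD u.1.fst) x + opD (opD v.1.fst) x := by
        rcases eq_or_lt_of_le hx.1 with rfl | h0
        · simp only [opD_zero, add_zero]
        · exact PreEnergySpace.opD_opD_add _ _ ⟨h0, hx.2⟩
      simp only [indicator_of_mem hx, freeSnd]
      rw [h, PreEnergySpace.dsnd_add _ _ hx]
      simp only [PreEnergySpace.snd_add, Pi.add_apply]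
      ring
  map_smul' c u := by
    refine PreEnergySpace.ext (fun x hx => ?_) (fun x hx => ?_)
    · change (Icc 0 1).indicator (freeFst (c • u.1)) x
        = c * (Icc 0 1).indicator (freeFst u.1) x
      simp only [indicator_of_mem hx, freeFst, PreEnergySpace.fst_smul, PreEnergySpace.snd_smul]
      rw [opK_smul, derivWithin_const_smul c (u.1.contDiff_fst.differentiableOn (by norm_num) x hx)]
      simp only [Pi.smul_apply, smul_eq_mul]
      ring
    · change (Icc 0 1).indicator (freeSnd (c • u.1)) x
        = c * (Icc 0 1).indicator (freeSnd u.1) x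
      have h : opD (opD (c • u.1).fst) x = c * opD (opD u.1.fst) x := by
        rcases eq_or_lt_of_le hx.1 with rfl | h0
        · simp only [opD_zero, mul_zero]
        · exact PreEnergySpace.opD_opD_smul _ _ ⟨h0, hx.2⟩
      simp only [indicator_of_mem hx, freeSnd]
      rw [h, PreEnergySpace.dsnd_smul _ _ hx]
      simp only [PreEnergySpace.snd_smul, Pi.smul_apply, smul_eq_mul]
      ring

/-- The canonical embedding of the pre-Hilbert space into its completion. -/
def embed : PreEnergySpace →ₗ[ℂ] EnergySpace :=
  (UniformSpace.Completion.toComplₗᵢ (𝕜 := ℂ) (E := PreEnergySpace)).toLinearMap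

theorem embed_injective : Function.Injective embed :=
  (UniformSpace.Completion.toComplₗᵢ (𝕜 := ℂ) (E := PreEnergySpace)).injective

/-- The free operator as an unbounded operator in the Hilbert space: its domain is the image of
`freeDomain` under the embedding, and it sends `embed u` to `embed (freePre u)`. -/
def freeOperator : EnergySpace →ₗ.[ℂ] EnergySpace where
  domain := freeDomain.map embed
  toFun := embed ∘ₗ freePre ∘ₗ
    (Submodule.equivMapOfInjective embed embed_injective freeDomain).symm.toLinearMap

/-- The graph of the free operator consists of the pairs `(embed u, embed (freePre u))`. -/
theorem mem_graph_freeOperator (x y : EnergySpace) : (x, y) ∈ freeOperator.graph ↔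
    ∃ u : freeDomain, embed u.1 = x ∧ embed (freePre u) = y := by
  rw [LinearPMap.mem_graph_iff]
  constructor
  · rintro ⟨z, hz, hy⟩
    obtain ⟨u, rfl⟩ := (Submodule.equivMapOfInjective embed embed_injective freeDomain).surjective z
    refine ⟨u, hz, Eq.trans ?_ hy⟩
    change _ = embed (freePre ((Submodule.equivMapOfInjective embed embed_injective
      freeDomain).symm _))
    rw [LinearEquiv.symm_apply_apply]
  · rintro ⟨u, hx, hy⟩
    refine ⟨Submodule.equivMapOfInjective embed embed_injective freeDomain u, hx, Eq.trans ?_ hy⟩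
    change embed (freePre ((Submodule.equivMapOfInjective embed embed_injective
      freeDomain).symm _)) = _
    rw [LinearEquiv.symm_apply_apply]

/-- `S : [0,∞) → B(E)` is a strongly continuous one-parameter semigroup. -/
structure IsC0Semigroup {E : Type*} [NormedAddCommGroup E] [NormedSpace ℂ E]
    (S : ℝ≥0 → E →L[ℂ] E) : Prop where
  map_zero : S 0 = ContinuousLinearMap.id ℂ E
  map_add : ∀ s t, S (s + t) = (S s).comp (S t)
  continuous_orbit : ∀ x, Continuous fun t => S t x

/-- `A` is the (infinitesimal) generator of `S`: `x` is in the domain of `A` with `A x = y` if and only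
if `(S(h)x - x)/h → y` as `h → 0+`. -/
def IsGenerator {E : Type*} [NormedAddCommGroup E] [NormedSpace ℂ E]
    (A : E →ₗ.[ℂ] E) (S : ℝ≥0 → E →L[ℂ] E) : Prop :=
  ∀ x y, (x, y) ∈ A.graph ↔
    Tendsto (fun h : ℝ≥0 => (((h : ℝ) : ℂ)⁻¹) • (S h x - x)) (𝓝[>] 0) (𝓝 y)

/-- `Φ : [0,∞) → E` is a mild solution of `Φ' = A Φ`, `Φ(0) = x`: it is continuous, and for every
`t ≥ 0` the integral `∫₀ᵗ Φ(s) ds` is in the domain of `A` and `Φ(t) = A ∫₀ᵗ Φ(s) ds + x`. -/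
structure IsMildSolution {E : Type*} [NormedAddCommGroup E] [NormedSpace ℂ E]
    (A : E →ₗ.[ℂ] E) (x : E) (Φ : ℝ≥0 → E) : Prop where
  continuous : Continuous Φ
  integral_mem : ∀ t : ℝ≥0, (∫ s in (0 : ℝ)..t, Φ s.toNNReal) ∈ A.domain
  eq_add : ∀ t : ℝ≥0, Φ t = A ⟨∫ s in (0 : ℝ)..t, Φ s.toNNReal, integral_mem t⟩ + x

end YangMills

end

/-! Put `p = D²u₁` and `q = u₂'`. The energy norm is the `L²` norm of `(p, q)`, and the operator
becomes the first-order system `(p, q) ↦ (-xp' - 2p + q', p' - xq' - 2q)`; the weights in `ρ²u₂ -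
3Ku₂` are exactly those for which all lower-order terms in `u₂` cancel. Extend `p` to `[-1,1]` as an
odd function and `q` as an even one. Then `f = p - q` is transformed by the single transport
operator `f ↦ -(1+x)f' - 2f`, up to a factor `1/√2` an isometric picture on `L²(-1,1)`.

Two facts follow. Integration by parts gives `2 Re(L₀u|u) = -3‖u‖² - |p(1) - q(1)|²`: the boundary
term at `0` vanishes because `p(0) = 0`, and the one at `1` has the good sign. And `f = (1+x)^k` is
an eigenfunction with eigenvalue `-(k+2)`; these functions span all polynomials in `x`, so by
Weierstrass the eigenvectors are total.

Instead of the Lumer–Phillips theorem, an elementary argument is used for any operator `A` with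
`Re⟪x, Ax⟫ ≤ -κ‖x‖²`, `κ > 0`, and a total sequence of eigenvectors `vᵢ` with eigenvalues `μᵢ ≠ 0`.
On their span the semigroup is multiplication of `vᵢ` by `e^{μᵢt}`. Dissipativity bounds it by
`e^{-κt}`, and it extends by density. Dissipativity also bounds `‖x‖` by `κ⁻¹‖Ax‖` on the closed
graph, so the closure of `A` on the span has closed range; the range contains every `vᵢ`, hence is
everything. An operator that is already onto has no proper injective extension: this identifies the
closure of `A` and the generator with that closure (`topologicalClosure_graph`, `isGenerator`). The
concrete input is `re_form_freePre_le`, `exists_eigenvector` and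
`denseRange_linearCombination_eigenvector`. -/

noncomputable section

namespace YangMills

/-! ### Dissipative operators with a total sequence of eigenvectors -/

section Abstract

variable {E : Type*} [NormedAddCommGroup E] [InnerProductSpace ℂ E]

theorem hasDerivAt_norm_sq_complex {f : ℝ → E} {f' : E} {t : ℝ} (h : HasDerivAt f f' t) :
    HasDerivAt (fun t => ‖f t‖ ^ 2) (2 * (inner ℂ (f t) f').re) t := by
  have h1 := Complex.reCLM.hasFDerivAt.comp_hasDerivAt t (h.inner ℂ h)
  have h2 : (fun t => ‖f t‖ ^ 2) = Complex.reCLM ∘ fun t => inner ℂ (f t) (f t) := by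
    funext s
    exact (inner_self_eq_norm_sq (𝕜 := ℂ) (f s)).symm
  rw [h2]
  refine h1.congr_deriv ?_
  simp only [Complex.reCLM_apply, Complex.add_re]
  have : (inner ℂ f' (f t)).re = (inner ℂ (f t) f').re := inner_re_symm (𝕜 := ℂ) _ _
  linarith

/-- A curve whose velocity satisfies `Re⟪f, f'⟫ ≤ -κ ‖f‖²` decays at the rate `e^{-κt}`. -/
theorem norm_le_exp_of_dissipative {f f' : ℝ → E} {κ : ℝ}
    (h : ∀ t, HasDerivAt f (f' t) t)
    (hd : ∀ t, 0 ≤ t → (inner ℂ (f t) (f' t)).re ≤ -κ * ‖f t‖ ^ 2) {t : ℝ} (ht : 0 ≤ t) :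
    ‖f t‖ ≤ Real.exp (-κ * t) * ‖f 0‖ := by
  have hg : ∀ s, HasDerivAt (fun s => Real.exp (2 * κ * s) * ‖f s‖ ^ 2)
      (Real.exp (2 * κ * s) * (2 * κ) * ‖f s‖ ^ 2
        + Real.exp (2 * κ * s) * (2 * (inner ℂ (f s) (f' s)).re)) s := fun s => by
    have h1 : HasDerivAt (fun s => Real.exp (2 * κ * s)) (Real.exp (2 * κ * s) * (2 * κ)) s := by
      simpa using ((hasDerivAt_id s).const_mul (2 * κ)).exp
    exact h1.mul (hasDerivAt_norm_sq_complex (h s))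
  -- Gronwall with the integrating factor `e^{2κs}` for `‖f‖²`.
  have hanti : AntitoneOn (fun s => Real.exp (2 * κ * s) * ‖f s‖ ^ 2) (Ici 0) := by
    refine antitoneOn_of_deriv_nonpos (convex_Ici 0)
      (fun s _ => (hg s).continuousAt.continuousWithinAt)
      (fun s _ => (hg s).differentiableAt.differentiableWithinAt) fun s hs => ?_
    rw [interior_Ici] at hs
    rw [(hg s).deriv]
    nlinarith [mul_le_mul_of_nonneg_left (hd s (le_of_lt hs)) (Real.exp_pos (2 * κ * s)).le]
  have h0 := hanti (self_mem_Ici (a := (0 : ℝ))) ht ht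
  simp only [mul_zero, Real.exp_zero, one_mul] at h0
  have h1 : Real.exp (2 * κ * t) = Real.exp (κ * t) ^ 2 := by
    rw [← Real.exp_nat_mul]; congr 1; push_cast; ring
  rw [h1, ← mul_pow] at h0
  have h2 := (sq_le_sq₀ (by positivity) (norm_nonneg _)).1 h0
  rw [neg_mul, Real.exp_neg, inv_mul_eq_div, le_div_iff₀' (Real.exp_pos _)]
  exact h2

theorem tendsto_coe_nhdsGT_zero :
    Tendsto (fun r : ℝ≥0 => (r : ℝ)) (𝓝[>] 0) (𝓝[≠] 0) := by
  refine tendsto_nhdsWithin_iff.2 ⟨?_, ?_⟩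
  · exact (NNReal.continuous_coe.tendsto 0).mono_left nhdsWithin_le_nhds
  · filter_upwards [self_mem_nhdsWithin] with r hr
    exact NNReal.coe_ne_zero.2 (ne_of_gt hr)

/-- The curve `t ↦ ∑ cᵢ e^{μᵢ t} vᵢ`, as a linear function of the coefficients. -/
def expComb (v : ℕ → E) (μ : ℕ → ℂ) (t : ℝ) : (ℕ →₀ ℂ) →ₗ[ℂ] E :=
  Finsupp.linearCombination ℂ fun i => Complex.exp (μ i * t) • v i

theorem expComb_zero (v : ℕ → E) (μ : ℕ → ℂ) :
    expComb v μ 0 = Finsupp.linearCombination ℂ v := by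
  simp [expComb]

theorem hasDerivAt_expComb (v : ℕ → E) (μ : ℕ → ℂ) (c : ℕ →₀ ℂ) (t : ℝ) :
    HasDerivAt (fun t => expComb v μ t c) (expComb (fun i => μ i • v i) μ t c) t := by
  simp only [expComb, Finsupp.linearCombination_apply, Finsupp.sum]
  refine HasDerivAt.fun_sum fun i _ => HasDerivAt.const_smul (c i) ?_
  have h1 : HasDerivAt (fun t : ℝ => Complex.exp (μ i * t)) (Complex.exp (μ i * t) * μ i) t := by
    have := ((Complex.ofRealCLM.hasDerivAt (x := t)).const_mul (μ i)).cexp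
    simpa using this
  simpa [smul_smul] using h1.smul_const (v i)

/-- The hypotheses under which a semigroup is constructed: `A` is strictly dissipative, and it has
a total sequence of eigenvectors. -/
structure HasTotalEigenvectors (A : E →ₗ.[ℂ] E) (κ : ℝ) (v : ℕ → E) (μ : ℕ → ℂ) : Prop where
  pos : 0 < κ
  dissipative : ∀ x y, (x, y) ∈ A.graph → (inner ℂ x y).re ≤ -κ * ‖x‖ ^ 2
  mem_graph : ∀ i, (v i, μ i • v i) ∈ A.graph
  ne_zero : ∀ i, μ i ≠ 0
  dense : DenseRange (Finsupp.linearCombination ℂ v)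

namespace HasTotalEigenvectors

variable {A : E →ₗ.[ℂ] E} {κ : ℝ} {v : ℕ → E} {μ : ℕ → ℂ}

theorem expComb_mem_graph (h : HasTotalEigenvectors A κ v μ) (t : ℝ) (c : ℕ →₀ ℂ) :
    (expComb v μ t c, expComb (fun i => μ i • v i) μ t c) ∈ A.graph := by
  induction c using Finsupp.induction_linear with
  | zero => simpa only [map_zero, Prod.mk_zero_zero] using A.graph.zero_mem
  | add c d hc hd => simpa only [map_add] using! A.graph.add_mem hc hd
  | single i a =>
    have := A.graph.smul_mem (a * Complex.exp (μ i * t)) (h.mem_graph i)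
    simpa only [expComb, Finsupp.linearCombination_single, smul_smul, Prod.smul_mk, mul_assoc]
      using this

/-- The curve solves `f' = Af`, so dissipativity applies to it. The bound is by the norm of `∑
cᵢvᵢ`, not by the coefficients: it shows both that the value depends only on this vector, so that
linear independence of the `vᵢ` is never needed, and that the map is bounded. -/
theorem norm_expComb_le (h : HasTotalEigenvectors A κ v μ) {t : ℝ} (ht : 0 ≤ t) (c : ℕ →₀ ℂ) :
    ‖expComb v μ t c‖ ≤ Real.exp (-κ * t) * ‖Finsupp.linearCombination ℂ v c‖ := by
  rw [← expComb_zero v μ]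
  exact norm_le_exp_of_dissipative (fun t => hasDerivAt_expComb v μ c t)
    (fun t _ => h.dissipative _ _ (h.expComb_mem_graph t c)) ht

theorem ext_clm (h : HasTotalEigenvectors A κ v μ) {S T : E →L[ℂ] E}
    (hST : ∀ c, S (Finsupp.linearCombination ℂ v c) = T (Finsupp.linearCombination ℂ v c)) :
    S = T :=
  ContinuousLinearMap.coeFn_injective (h.dense.equalizer S.continuous T.continuous (funext hST))

/-- The graph of the closure of the restriction of `A` to the span of the eigenvectors. -/
def coreGraph (v : ℕ → E) (μ : ℕ → ℂ) : Submodule ℂ (E × E) :=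
  (LinearMap.range ((Finsupp.linearCombination ℂ v).prod
    (Finsupp.linearCombination ℂ fun i => μ i • v i))).topologicalClosure

theorem coreGraph_le (h : HasTotalEigenvectors A κ v μ) :
    coreGraph v μ ≤ A.graph.topologicalClosure := by
  refine Submodule.topologicalClosure_mono ?_
  rintro _ ⟨c, rfl⟩
  have := h.expComb_mem_graph 0 c
  rwa [expComb_zero, expComb_zero] at this

/-- The inequality is a closed condition on pairs, so it survives before the closure of the graph is
known to be a graph. -/
theorem dissipative_closure (h : HasTotalEigenvectors A κ v μ) {x y : E}
    (hxy : (x, y) ∈ A.graph.topologicalClosure) : (inner ℂ x y).re ≤ -κ * ‖x‖ ^ 2 := by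
  have hcl : IsClosed {z : E × E | (inner ℂ z.1 z.2).re ≤ -κ * ‖z.1‖ ^ 2} :=
    isClosed_le (Complex.continuous_re.comp (by fun_prop)) (by fun_prop)
  exact closure_minimal (fun z hz => h.dissipative z.1 z.2 hz) hcl hxy

theorem coreGraph_induction {P : E × E → Prop} (hcl : IsClosed {z | P z})
    (hP : ∀ c, P (Finsupp.linearCombination ℂ v c,
      Finsupp.linearCombination ℂ (fun i => μ i • v i) c)) {z : E × E} (hz : z ∈ coreGraph v μ) :
    P z := by
  refine closure_minimal ?_ hcl hz
  rintro _ ⟨c, rfl⟩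
  exact hP c

/-- Cauchy–Schwarz turns dissipativity into `κ‖x‖² ≤ ‖x‖‖y‖`. This is injectivity with a bounded
inverse for the closed relation. -/
theorem norm_fst_le (h : HasTotalEigenvectors A κ v μ) {x y : E}
    (hxy : (x, y) ∈ A.graph.topologicalClosure) : ‖x‖ ≤ κ⁻¹ * ‖y‖ := by
  have h1 := h.dissipative_closure hxy
  have h2 : -(‖x‖ * ‖y‖) ≤ (inner ℂ x y).re :=
    (abs_le.1 ((Complex.abs_re_le_norm _).trans (norm_inner_le_norm x y))).1
  rw [inv_mul_eq_div, le_div_iff₀' h.pos]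
  rcases (norm_nonneg x).eq_or_lt' with h0 | h0
  · rw [h0]; simp
  · nlinarith

/-! ### The semigroup -/

variable [CompleteSpace E]

/-- The semigroup that acts on the eigenvector `vᵢ` by multiplication with `e^{μᵢ t}`. -/
def semigroup (v : ℕ → E) (μ : ℕ → ℂ) (t : ℝ≥0) : E →L[ℂ] E :=
  (expComb v μ t).extendOfNorm (Finsupp.linearCombination ℂ v)

theorem semigroup_apply (h : HasTotalEigenvectors A κ v μ) (t : ℝ≥0) (c : ℕ →₀ ℂ) :
    semigroup v μ t (Finsupp.linearCombination ℂ v c) = expComb v μ t c :=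
  LinearMap.extendOfNorm_eq h.dense ⟨_, h.norm_expComb_le t.2⟩ c

theorem norm_semigroup_le (h : HasTotalEigenvectors A κ v μ) (t : ℝ≥0) :
    ‖semigroup v μ t‖ ≤ Real.exp (-κ * t) :=
  LinearMap.opNorm_extendOfNorm_le h.dense (Real.exp_pos _).le (h.norm_expComb_le t.2)

theorem norm_semigroup_le_one (h : HasTotalEigenvectors A κ v μ) (t : ℝ≥0) :
    ‖semigroup v μ t‖ ≤ 1 :=
  (h.norm_semigroup_le t).trans (Real.exp_le_one_iff.2 (by nlinarith [h.pos, t.2]))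

theorem semigroup_expComb (h : HasTotalEigenvectors A κ v μ) (t : ℝ≥0) (s : ℝ) (c : ℕ →₀ ℂ) :
    semigroup v μ t (expComb v μ s c) = expComb v μ (t + s) c := by
  induction c using Finsupp.induction_linear with
  | zero => simp
  | add c d hc hd => simp [hc, hd]
  | single i a =>
    have e := h.semigroup_apply t (Finsupp.single i (a * Complex.exp (μ i * s)))
    simp only [expComb, Finsupp.linearCombination_single, smul_smul] at e ⊢
    rw [e, mul_assoc, ← Complex.exp_add]
    congr 3
    push_cast
    ring_nf

theorem isC0Semigroup (h : HasTotalEigenvectors A κ v μ) : IsC0Semigroup (semigroup v μ) where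
  map_zero := by
    refine h.ext_clm fun c => ?_
    rw [h.semigroup_apply, NNReal.coe_zero, expComb_zero]
    rfl
  map_add s t := by
    refine h.ext_clm fun c => ?_
    rw [h.semigroup_apply, ContinuousLinearMap.comp_apply, h.semigroup_apply, h.semigroup_expComb]
    rfl
  continuous_orbit x := by
    -- As all operators are contractions, approximating `x` in the span approximates its orbit
    -- uniformly in time, and orbits in the span are smooth.
    refine continuous_of_uniform_approx_of_continuous fun u hu => ?_
    obtain ⟨ε, hε, hεu⟩ := Metric.mem_uniformity_dist.1 hu
    obtain ⟨c, hc⟩ := h.dense.exists_dist_lt x hε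
    refine ⟨fun t => expComb v μ t c, ?_, fun t => hεu ?_⟩
    · exact (continuous_iff_continuousAt.2 fun t =>
        (hasDerivAt_expComb v μ c t).continuousAt).comp NNReal.continuous_coe
    · change dist _ (expComb v μ t c) < ε
      rw [← h.semigroup_apply, dist_eq_norm, ← map_sub]
      calc _ ≤ 1 * ‖x - Finsupp.linearCombination ℂ v c‖ :=
            (semigroup v μ t).le_of_opNorm_le (h.norm_semigroup_le_one t) _
        _ < ε := by rwa [one_mul, ← dist_eq_norm]

theorem continuous_orbit_toNNReal (h : HasTotalEigenvectors A κ v μ) (x : E) :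
    Continuous fun s : ℝ => semigroup v μ s.toNNReal x :=
  (h.isC0Semigroup.continuous_orbit x).comp continuous_real_toNNReal

theorem semigroup_mem_coreGraph (h : HasTotalEigenvectors A κ v μ) (t : ℝ≥0) {x y : E}
    (hxy : (x, y) ∈ coreGraph v μ) : (semigroup v μ t x, semigroup v μ t y) ∈ coreGraph v μ := by
  refine coreGraph_induction (v := v) (μ := μ)
    (P := fun z => (semigroup v μ t z.1, semigroup v μ t z.2) ∈ coreGraph v μ) ?_ (fun c => ?_) hxy
  · exact (Submodule.isClosed_topologicalClosure _).preimage (by fun_prop)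
  · induction c using Finsupp.induction_linear with
    | zero => simpa only [map_zero, Prod.mk_zero_zero] using (coreGraph v μ).zero_mem
    | add c d hc hd => simpa only [map_add] using! (coreGraph v μ).add_mem hc hd
    | single i a =>
      have e := h.semigroup_apply t (Finsupp.single i a)
      have e' := h.semigroup_apply t (Finsupp.single i (a * μ i))
      -- On the span the semigroup rescales the coefficients, and this commutes with multiplication
      -- by `μᵢ`.
      refine Submodule.le_topologicalClosure _
        ⟨Finsupp.single i (a * Complex.exp (μ i * t)), ?_⟩
      simp only [expComb, Finsupp.linearCombination_single, smul_smul, LinearMap.prod_apply,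
        Function.prod] at e e' ⊢
      rw [e, e']
      congr 2
      ring

/-- For `x` in the span this is the fundamental theorem of calculus along the explicit exponentials.
Both sides are continuous in `(x, y)`, so the identity passes to the closure. -/
theorem integral_orbit (h : HasTotalEigenvectors A κ v μ) (t : ℝ≥0) {x y : E}
    (hxy : (x, y) ∈ coreGraph v μ) :
    ∫ s in (0 : ℝ)..t, semigroup v μ s.toNNReal y = semigroup v μ t x - x := by
  refine coreGraph_induction (v := v) (μ := μ) (P := fun z =>
    ∫ s in (0 : ℝ)..t, semigroup v μ s.toNNReal z.2 = semigroup v μ t z.1 - z.1) ?_ (fun c => ?_) hxy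
  · refine isClosed_eq ?_ (by fun_prop)
    have hcont : Continuous fun y : E => ∫ s in (0 : ℝ)..t, semigroup v μ s.toNNReal y := by
      -- The integrand is a contraction of `y` and the interval has length `t`.
      refine LipschitzWith.continuous (K := t) (LipschitzWith.of_dist_le_mul fun y z => ?_)
      rw [dist_eq_norm, ← intervalIntegral.integral_sub
        ((h.continuous_orbit_toNNReal y).intervalIntegrable _ _)
        ((h.continuous_orbit_toNNReal z).intervalIntegrable _ _), dist_eq_norm]
      refine (intervalIntegral.norm_integral_le_of_norm_le_const
        (C := ‖y - z‖) fun s _ => ?_).trans_eq ?_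
      · rw [← map_sub]
        simpa using (semigroup v μ s.toNNReal).le_of_opNorm_le (h.norm_semigroup_le_one _) (y - z)
      · rw [sub_zero, abs_of_nonneg t.coe_nonneg, mul_comm]
    exact hcont.comp continuous_snd
  · have hder : ∀ s : ℝ, 0 ≤ s → semigroup v μ s.toNNReal
        (Finsupp.linearCombination ℂ (fun i => μ i • v i) c)
        = expComb (fun i => μ i • v i) μ s c := by
      intro s hs
      induction c using Finsupp.induction_linear with
      | zero => simp
      | add c d hc hd => simp [hc, hd]
      | single i a =>
        have e := h.semigroup_apply s.toNNReal (Finsupp.single i (a * μ i))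
        rw [Real.coe_toNNReal _ hs] at e
        simp only [expComb, Finsupp.linearCombination_single, smul_smul] at e ⊢
        rw [e]
        congr 1
        ring
    have h1 : ∫ s in (0 : ℝ)..t, semigroup v μ s.toNNReal
        (Finsupp.linearCombination ℂ (fun i => μ i • v i) c)
        = ∫ s in (0 : ℝ)..t, expComb (fun i => μ i • v i) μ s c := by
      refine intervalIntegral.integral_congr fun s hs => hder s ?_
      rw [uIcc_of_le t.coe_nonneg] at hs
      exact hs.1
    change ∫ s in (0 : ℝ)..t, semigroup v μ s.toNNReal
        (Finsupp.linearCombination ℂ (fun i => μ i • v i) c) = _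
    rw [h1, intervalIntegral.integral_eq_sub_of_hasDerivAt
      (fun s _ => hasDerivAt_expComb v μ c s)
      ((continuous_iff_continuousAt.2 fun s =>
        (hasDerivAt_expComb _ μ c s).continuousAt).intervalIntegrable _ _), h.semigroup_apply,
      expComb_zero]

/-! ### Closure and generator -/

/-- The integral formula makes the difference quotient an average of the continuous orbit of `y`
over `[0, r]`. -/
theorem tendsto_quotient (h : HasTotalEigenvectors A κ v μ) {x y : E}
    (hxy : (x, y) ∈ coreGraph v μ) :
    Tendsto (fun r : ℝ≥0 => (((r : ℝ) : ℂ)⁻¹) • (semigroup v μ r x - x)) (𝓝[>] 0) (𝓝 y) := by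
  have hc := h.continuous_orbit_toNNReal y
  have h1 := (hc.integral_hasStrictDerivAt 0 0).hasDerivAt
  rw [hasDerivAt_iff_tendsto_slope, Real.toNNReal_zero, h.isC0Semigroup.map_zero] at h1
  refine (h1.comp tendsto_coe_nhdsGT_zero).congr fun r => ?_
  simp only [Function.comp, slope_def_module, intervalIntegral.integral_same, sub_zero]
  rw [h.integral_orbit r hxy, ← Complex.ofReal_inv]
  exact (Complex.coe_smul _ _).symm

/-- Injectivity of the generator: `Re⟪x, S(r)x - x⟫ ≤ (e^{-κr} - 1)‖x‖²`, and dividing by `r → 0`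
leaves `0 ≤ -κ‖x‖²`. -/
theorem eq_zero_of_tendsto_quotient (h : HasTotalEigenvectors A κ v μ) {x : E}
    (hx : Tendsto (fun r : ℝ≥0 => (((r : ℝ) : ℂ)⁻¹) • (semigroup v μ r x - x)) (𝓝[>] 0) (𝓝 0)) :
    x = 0 := by
  have h1 : Tendsto (fun r : ℝ≥0 => (inner ℂ x ((((r : ℝ) : ℂ)⁻¹) • (semigroup v μ r x - x))).re)
      (𝓝[>] 0) (𝓝 0) := by
    have := (Complex.continuous_re.tendsto _).comp ((tendsto_const_nhds (x := x)).inner hx (𝕜 := ℂ))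
    rwa [inner_zero_right, Complex.zero_re] at this
  have h2 : Tendsto (fun r : ℝ≥0 => (r : ℝ)⁻¹ * (Real.exp (-κ * r) - 1) * ‖x‖ ^ 2)
      (𝓝[>] 0) (𝓝 (-κ * ‖x‖ ^ 2)) := by
    have hd : HasDerivAt (fun r : ℝ => Real.exp (-κ * r)) (-κ) 0 := by
      simpa using ((hasDerivAt_id (0 : ℝ)).const_mul (-κ)).exp
    rw [hasDerivAt_iff_tendsto_slope] at hd
    refine ((hd.comp tendsto_coe_nhdsGT_zero).mul_const _).congr fun r => ?_
    simp [slope_def_field, div_eq_inv_mul]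
  have h3 : (0 : ℝ) ≤ -κ * ‖x‖ ^ 2 := by
    refine le_of_tendsto_of_tendsto' h1 h2 fun r => ?_
    rw [inner_smul_right, ← Complex.ofReal_inv, Complex.re_ofReal_mul, mul_assoc]
    refine mul_le_mul_of_nonneg_left ?_ (inv_nonneg.2 r.2)
    rw [inner_sub_right, Complex.sub_re]
    have h4 : (inner ℂ x x).re = ‖x‖ ^ 2 := inner_self_eq_norm_sq (𝕜 := ℂ) x
    have h5 : (inner ℂ x (semigroup v μ r x)).re ≤ ‖x‖ * ‖semigroup v μ r x‖ :=
      re_inner_le_norm (𝕜 := ℂ) _ _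
    have h6 := (semigroup v μ r).le_of_opNorm_le (h.norm_semigroup_le r) x
    nlinarith [mul_le_mul_of_nonneg_left h6 (norm_nonneg x)]
  have h4 : ‖x‖ ^ 2 ≤ 0 := by nlinarith [h.pos, sq_nonneg ‖x‖]
  exact norm_eq_zero.1 (pow_eq_zero_iff two_ne_zero |>.1 (le_antisymm h4 (sq_nonneg _)))

/-- Surjectivity. The projection of the closed graph to its second coordinate is bounded below, so
its range is closed; the range contains the span, which is dense. -/
theorem exists_mem_coreGraph (h : HasTotalEigenvectors A κ v μ) (y : E) :
    ∃ x, (x, y) ∈ coreGraph v μ := by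
  let π : coreGraph v μ →L[ℂ] E :=
    (ContinuousLinearMap.snd ℂ E E).comp (coreGraph v μ).subtypeL
  have hcomplete : CompleteSpace (coreGraph v μ) :=
    (Submodule.isClosed_topologicalClosure _).completeSpace_coe
  -- The product carries the maximum norm: `κ⁻¹` controls the first coordinate, `1` the second.
  have hanti : AntilipschitzWith (max κ⁻¹ 1).toNNReal π := by
    refine AddMonoidHomClass.antilipschitz_of_bound π fun z => ?_
    have h1 := h.norm_fst_le (h.coreGraph_le z.2)
    rw [Real.coe_toNNReal _ (le_max_of_le_right zero_le_one)]
    change max ‖z.1.1‖ ‖z.1.2‖ ≤ _ * ‖z.1.2‖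
    refine max_le (h1.trans ?_) ?_
    · gcongr; exact le_max_left _ _
    · nlinarith [le_max_right κ⁻¹ 1, norm_nonneg z.1.2]
  have hclosed : IsClosed (range π) := hanti.isClosed_range π.uniformContinuous
  have hsub : range (Finsupp.linearCombination ℂ v) ⊆ range π := by
    rintro _ ⟨c, rfl⟩
    change _ ∈ LinearMap.range π.toLinearMap
    induction c using Finsupp.induction_linear with
    | zero => simp
    | add c d hc hd => rw [map_add]; exact Submodule.add_mem _ hc hd
    | single i a =>
      -- A preimage of `a vᵢ` is `a μᵢ⁻¹ vᵢ`; here the eigenvalues have to be nonzero.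
      refine ⟨⟨_, Submodule.le_topologicalClosure _ ⟨Finsupp.single i (a * (μ i)⁻¹), rfl⟩⟩, ?_⟩
      change Finsupp.linearCombination ℂ (fun i => μ i • v i) _ = _
      rw [Finsupp.linearCombination_single, Finsupp.linearCombination_single, smul_smul,
        inv_mul_cancel_right₀ (h.ne_zero i)]
  have huniv : range π = univ :=
    univ_subset_iff.1 ((h.dense.closure_eq).symm.subset.trans (closure_minimal hsub hclosed))
  obtain ⟨z, hz⟩ := huniv.symm.subset (mem_univ y)
  refine ⟨z.1.1, ?_⟩
  rw [← hz]
  exact z.2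

/-- The smaller relation is already onto and the larger one is injective, so they agree: a pair `(x,
y)` of the larger shares `y` with a pair `(x', y)` of the smaller, and then `x = x'`. -/
theorem topologicalClosure_graph (h : HasTotalEigenvectors A κ v μ) :
    A.graph.topologicalClosure = coreGraph v μ := by
  refine le_antisymm ?_ h.coreGraph_le
  rintro ⟨x, y⟩ hxy
  obtain ⟨x', hx'⟩ := h.exists_mem_coreGraph y
  have := Submodule.sub_mem _ hxy (h.coreGraph_le hx')
  rw [Prod.mk_sub_mk, sub_self] at this
  have h0 := h.norm_fst_le this
  rw [norm_zero, mul_zero, norm_le_zero_iff, sub_eq_zero] at h0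
  rwa [h0]

/-- If `(0, y)` lies in the closed graph, then `y` is the limit of the difference quotients of the
orbit of `0`, which vanish. -/
theorem isClosable (h : HasTotalEigenvectors A κ v μ) : A.IsClosable := by
  refine ⟨A.graph.topologicalClosure.toLinearPMap, (Submodule.toLinearPMap_graph_eq _ ?_).symm⟩
  rintro ⟨x, y⟩ hxy (rfl : x = 0)
  rw [h.topologicalClosure_graph] at hxy
  refine tendsto_nhds_unique (h.tendsto_quotient hxy) ?_
  simp

theorem graph_closure (h : HasTotalEigenvectors A κ v μ) : A.closure.graph = coreGraph v μ := by
  rw [← h.isClosable.graph_closure_eq_closure_graph, h.topologicalClosure_graph]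

/-- The generator extends the closure, which is onto, and the generator is injective; so there is no
room for a proper extension. -/
theorem isGenerator (h : HasTotalEigenvectors A κ v μ) :
    IsGenerator A.closure (semigroup v μ) := by
  intro x y
  rw [h.graph_closure]
  refine ⟨h.tendsto_quotient, fun hxy => ?_⟩
  obtain ⟨x', hx'⟩ := h.exists_mem_coreGraph y
  have h1 := hxy.sub (h.tendsto_quotient hx')
  rw [sub_self] at h1
  have h2 : x - x' = 0 := h.eq_zero_of_tendsto_quotient <| h1.congr fun r => by
    rw [← smul_sub, map_sub]
    congr 1
    abel
  rwa [sub_eq_zero.1 h2]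

/-! ### Mild solutions -/

theorem isMildSolution (h : HasTotalEigenvectors A κ v μ) (x : E) :
    IsMildSolution A.closure x fun t => semigroup v μ t x := by
  -- Writing `x` as the image of `x'` under the closure of `A` gives `∫₀ᵗ S(s)x ds = S(t)x' - x'`,
  -- which is visibly in the domain.
  obtain ⟨x', hx'⟩ := h.exists_mem_coreGraph x
  have hmem : ∀ t : ℝ≥0, (∫ s in (0 : ℝ)..t, semigroup v μ s.toNNReal x, semigroup v μ t x - x) ∈
      A.closure.graph := fun t => by
    rw [h.graph_closure, h.integral_orbit t hx']
    exact Submodule.sub_mem _ (h.semigroup_mem_coreGraph t hx') hx'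
  refine ⟨h.isC0Semigroup.continuous_orbit x,
    fun t => LinearPMap.mem_domain_of_mem_graph (hmem t), fun t => ?_⟩
  have := A.closure.mem_graph_snd_inj (hmem t)
    (A.closure.mem_graph ⟨_, LinearPMap.mem_domain_of_mem_graph (hmem t)⟩) rfl
  rw [← this, sub_add_cancel]

/-- The integrated difference `W(t) = ∫₀ᵗ (Φ - Ψ)` is differentiable and solves `W' = AW` (`A`
closed), `W(0) = 0`. Dissipativity forces `W = 0`, hence `Φ - Ψ = AW = 0`. -/
theorem eq_of_isMildSolution (h : HasTotalEigenvectors A κ v μ) {x : E} {Φ Ψ : ℝ≥0 → E}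
    (hΦ : IsMildSolution A.closure x Φ) (hΨ : IsMildSolution A.closure x Ψ) : Φ = Ψ := by
  have hmem : ∀ {Φ : ℝ≥0 → E}, IsMildSolution A.closure x Φ → ∀ t : ℝ≥0,
      (∫ s in (0 : ℝ)..t, Φ s.toNNReal, Φ t - x) ∈ A.closure.graph := fun hΦ t => by
    rw [sub_eq_of_eq_add (hΦ.eq_add t)]
    exact A.closure.mem_graph ⟨_, hΦ.integral_mem t⟩
  have hcΦ : Continuous fun s : ℝ => Φ s.toNNReal := hΦ.continuous.comp continuous_real_toNNReal
  have hcΨ : Continuous fun s : ℝ => Ψ s.toNNReal := hΨ.continuous.comp continuous_real_toNNReal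
  have hdiff : ∀ t : ℝ≥0, (∫ s in (0 : ℝ)..t, (Φ s.toNNReal - Ψ s.toNNReal), Φ t - Ψ t)
      ∈ A.closure.graph := fun t => by
    have := Submodule.sub_mem _ (hmem hΦ t) (hmem hΨ t)
    rw [Prod.mk_sub_mk, sub_sub_sub_cancel_right] at this
    rwa [intervalIntegral.integral_sub (hcΦ.intervalIntegrable _ _) (hcΨ.intervalIntegrable _ _)]
  have hzero : ∀ t : ℝ≥0, ∫ s in (0 : ℝ)..t, (Φ s.toNNReal - Ψ s.toNNReal) = 0 := fun t => by
    -- `toNNReal` extends the integrand continuously to negative times, so the derivative exists on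
    -- all of `ℝ`; the differential equation is needed only for `t ≥ 0`.
    have := norm_le_exp_of_dissipative (κ := κ)
      (fun t => ((hcΦ.sub hcΨ).integral_hasStrictDerivAt 0 t).hasDerivAt) (fun t ht => by
        have hd := hdiff t.toNNReal
        rw [Real.coe_toNNReal t ht] at hd
        refine h.dissipative_closure ?_
        rw [h.isClosable.graph_closure_eq_closure_graph]
        exact hd) t.2
    simpa using this
  funext t
  have := hdiff t
  rw [hzero t] at this
  exact sub_eq_zero.1 (A.closure.graph_fst_eq_zero_snd this rfl)

end HasTotalEigenvectors

end Abstract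

/-! ### The operator in the variables `p = D²u₁`, `q = u₂'` -/

/-- The first component of the free operator is designed such that `D²` of it is
`-ρ p' - 2 p + q'`, where `p = D² u₁` and `q = u₂'`. -/
theorem opD_opD_freePre (u : freeDomain) {x : ℝ} (hx : x ∈ Ioc (0 : ℝ) 1) :
    opD (opD (freePre u).fst) x = -(x : ℂ) * derivWithin (opD (opD u.1.fst)) (Icc 0 1) x
      - 2 * opD (opD u.1.fst) x + derivWithin (derivWithin u.1.snd (Icc 0 1)) (Icc 0 1) x := by
  obtain ⟨u, hu⟩ := u
  have hxI : x ∈ Icc (0 : ℝ) 1 := Ioc_subset_Icc_self hx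
  have h0 : (x : ℂ) ≠ 0 := by exact_mod_cast hx.1.ne'
  set d := fun k => iteratedDerivWithin k u.fst (Icc (0 : ℝ) 1) with hd
  set e := fun k => iteratedDerivWithin k u.snd (Icc (0 : ℝ) 1) with he
  have h1 : ∀ k, ∀ x ∈ Icc (0 : ℝ) 1, HasDerivWithinAt (d k) (d (k + 1) x) (Icc 0 1) x :=
    fun k x hx => hasDerivWithinAt_iter hu.1 (lt_infty k) hx
  have h2 : ∀ k, ∀ x ∈ Icc (0 : ℝ) 1, HasDerivWithinAt (e k) (e (k + 1) x) (Icc 0 1) x :=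
    fun k x hx => hasDerivWithinAt_iter hu.2.1 (lt_infty k) hx
  have hX : ∀ x, HasDerivWithinAt (fun x : ℝ => (x : ℂ)) 1 (Icc 0 1) x := fun x =>
    Complex.ofRealCLM.hasDerivAt.hasDerivWithinAt
  have hX2 : ∀ x : ℝ, HasDerivWithinAt (fun x : ℝ => (x : ℂ) ^ 2) (2 * (x : ℂ)) (Icc 0 1) x :=
    fun x => HasDerivWithinAt.congr_deriv ((hX x).pow 2) (by norm_num)
  -- The component and its first two derivatives. Since `(ρ²u₂ - 3Ku₂)' = ρ²u₂' - ρu₂`, the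
  -- combination `F₂/x² - F₁/x³` retains only `u₂''` of the terms in `u₂`.
  let F : ℕ → ℝ → ℂ
    | 0 => fun x => -(x : ℂ) * d 1 x + 2 * d 0 x + (x : ℂ) ^ 2 * e 0 x - 3 * opK u.snd x
    | 1 => fun x => -(x : ℂ) * d 2 x + d 1 x + (x : ℂ) ^ 2 * e 1 x - (x : ℂ) * e 0 x
    | _ => fun x => -(x : ℂ) * d 3 x + (x : ℂ) ^ 2 * e 2 x + (x : ℂ) * e 1 x - e 0 x
  have hF0 : F 0 = freeFst u := by
    funext x
    simp only [F, freeFst, hd, he, iteratedDerivWithin_one, iteratedDerivWithin_zero]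
  have hch : ∀ k < 2, ∀ x ∈ Icc (0 : ℝ) 1,
      HasDerivWithinAt (F k) (F (k + 1) x) (Icc 0 1) x := by
    intro k hk x hx
    have hK := hasDerivWithinAt_opK hu.2.1.continuousOn hx
    have he0 : e 0 x = u.snd x := by simp [he]
    interval_cases k
    · refine HasDerivWithinAt.congr_deriv (((((hX x).neg.mul (h1 1 x hx)).add
        ((h1 0 x hx).const_mul 2)).add ((hX2 x).mul (h2 0 x hx))).sub (hK.const_mul 3)) ?_
      simp only [F, ← he0, Pi.neg_apply]
      ring
    · refine HasDerivWithinAt.congr_deriv (((((hX x).neg.mul (h1 2 x hx)).add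
        (h1 1 x hx)).add ((hX2 x).mul (h2 1 x hx))).sub ((hX x).mul (h2 0 x hx))) ?_
      simp only [F, Pi.neg_apply]
      ring
  have hiter : ∀ k ≤ 2,
      iteratedDerivWithin k (freePre ⟨u, hu⟩).fst (Icc 0 1) x = F k x := fun k hk => by
    rw [← iter_eq_of_chain hch k hk x hxI, hF0]
    exact iteratedDerivWithin_congr (eqOn_indicator (f := freeFst u)) hxI
  have hu2 : ContDiffOn ℝ 2 u.fst (Icc 0 1) := u.contDiff_fst.of_le (by norm_num)
  have hp : HasDerivWithinAt (opD (opD u.fst))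
      (d 3 x / (x : ℂ) ^ 2 - 3 * d 2 x / (x : ℂ) ^ 3 + 3 * d 1 x / (x : ℂ) ^ 4) (Icc 0 1) x := by
    have e1 := hasDerivWithinAt_inv_pow hx.1 2 (h1 1 x hxI)
    have e2 := hasDerivWithinAt_inv_pow hx.1 1 (h1 2 x hxI)
    refine ((e2.sub e1).congr_of_eventuallyEq
      (eventuallyEq_pos hx.1 (fun y hy => opD_opD hu2 hy)) (opD_opD hu2 hx)).congr_deriv ?_
    push_cast
    ring
  have hq : derivWithin (derivWithin u.snd (Icc 0 1)) (Icc 0 1) x = e 2 x := by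
    rw [← (h2 1 x hxI).derivWithin (uniqueDiff_I x hxI)]
    simp only [he, iteratedDerivWithin_one]
  rw [opD_opD ((freePre ⟨u, hu⟩).contDiff_fst.of_le (by norm_num)) hx, hiter 2 le_rfl,
    hiter 1 one_le_two, opD_opD hu2 hx, hp.derivWithin (uniqueDiff_I x hxI), hq]
  change F 2 x / _ - F 1 x / _ = -(x : ℂ) * _ - 2 * (d 2 x / _ - d 1 x / _) + _
  simp only [F]
  field_simp
  ring

/-- The derivative of the second component of the free operator is `p' - ρ q' - 2 q`, where
`p = D² u₁` and `q = u₂'`. -/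
theorem dsnd_freePre (u : freeDomain) {x : ℝ} (hx : x ∈ Icc (0 : ℝ) 1) :
    derivWithin (freePre u).snd (Icc 0 1) x = derivWithin (opD (opD u.1.fst)) (Icc 0 1) x
      - (x : ℂ) * derivWithin (derivWithin u.1.snd (Icc 0 1)) (Icc 0 1) x
      - 2 * derivWithin u.1.snd (Icc 0 1) x := by
  obtain ⟨u, hu⟩ := u
  have hp := ((contDiffOn_opD_opD hu.1 hu.2.2.1).differentiableOn one_ne_zero x hx).hasDerivWithinAt
  have hd : ContDiffOn ℝ ∞ (derivWithin u.snd (Icc 0 1)) (Icc 0 1) :=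
    ((contDiffOn_infty_iff_derivWithin uniqueDiff_I).1 hu.2.1).2
  have hq := (hd.differentiableOn (by simp) x hx).hasDerivWithinAt
  have hX : HasDerivWithinAt (fun x : ℝ => (x : ℂ)) 1 (Icc 0 1) x :=
    Complex.ofRealCLM.hasDerivAt.hasDerivWithinAt
  have h := (hp.sub (hX.mul hq)).sub (u.differentiableOn_snd x hx).hasDerivWithinAt
  have hE : EqOn (freePre ⟨u, hu⟩).snd (freeSnd u) (Icc 0 1) := eqOn_indicator
  rw [derivWithin_congr hE (hE hx)]
  refine (h.derivWithin (uniqueDiff_I x hx)).trans ?_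
  ring

theorem PreEnergySpace.norm_sq_eq (u : PreEnergySpace) : ‖u‖ ^ 2 =
    (∫ ρ in (0 : ℝ)..1, ‖opD (opD u.fst) ρ‖ ^ 2) +
      ∫ ρ in (0 : ℝ)..1, ‖derivWithin u.snd (Icc 0 1) ρ‖ ^ 2 := by
  have h : (inner ℂ u u).re = ‖u‖ ^ 2 := inner_self_eq_norm_sq (𝕜 := ℂ) u
  rw [← h, inner_eq_form, form_self, Complex.ofReal_re]

/-- The norm sees only `D²u₁` and `u₂'`. Eigenvalue equations can therefore be checked on the
first-order system. -/
theorem PreEnergySpace.ext_opD {u v : PreEnergySpace}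
    (h1 : ∀ x ∈ Ioc (0 : ℝ) 1, opD (opD u.fst) x = opD (opD v.fst) x)
    (h2 : ∀ x ∈ Ioc (0 : ℝ) 1,
      derivWithin u.snd (Icc 0 1) x = derivWithin v.snd (Icc 0 1) x) : u = v := by
  have hw : u + (-1 : ℂ) • v = 0 := by
    have e1 : ∫ ρ in (0 : ℝ)..1, ‖opD (opD (u + (-1 : ℂ) • v).fst) ρ‖ ^ 2
        = ∫ ρ in (0 : ℝ)..1, (0 : ℝ) := integral_congr' fun x hx => by
      rw [opD_opD_add _ _ hx, opD_opD_smul _ _ hx, h1 x hx]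
      simp
    have e2 : ∫ ρ in (0 : ℝ)..1, ‖derivWithin (u + (-1 : ℂ) • v).snd (Icc 0 1) ρ‖ ^ 2
        = ∫ ρ in (0 : ℝ)..1, (0 : ℝ) := integral_congr' fun x hx => by
      rw [dsnd_add _ _ (Ioc_subset_Icc_self hx), dsnd_smul _ _ (Ioc_subset_Icc_self hx), h2 x hx]
      simp
    rw [← norm_eq_zero, ← sq_eq_zero_iff, norm_sq_eq, e1, e2]
    simp
  rwa [neg_one_smul, ← sub_eq_add_neg, sub_eq_zero] at hw

/-! ### Energy estimate -/

/-- The energy estimate `Re (L₀u|u) ≤ -3/2 ‖u‖²`. -/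
theorem re_form_freePre_le (u : freeDomain) :
    (PreEnergySpace.form (freePre u) u.1).re ≤ -(3 / 2) * ‖u.1‖ ^ 2 := by
  set p := opD (opD u.1.fst) with hp
  set q := derivWithin u.1.snd (Icc 0 1) with hq
  set p' := derivWithin p (Icc 0 1) with hp'
  set q' := derivWithin q (Icc 0 1) with hq'
  have hcp : ContDiffOn ℝ 1 p (Icc 0 1) := contDiffOn_opD_opD u.2.1 u.2.2.2.1
  have hcq : ContDiffOn ℝ 1 q (Icc 0 1) :=
    ((contDiffOn_infty_iff_derivWithin uniqueDiff_I).1 u.2.2.1).2.of_le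
      (by exact_mod_cast (lt_infty 1).le)
  have hpc := hcp.continuousOn
  have hqc := hcq.continuousOn
  have hpc' : ContinuousOn p' (Icc 0 1) := hcp.continuousOn_derivWithin uniqueDiff_I le_rfl
  have hqc' : ContinuousOn q' (Icc 0 1) := hcq.continuousOn_derivWithin uniqueDiff_I le_rfl
  let c : ℂ → ℂ := starRingEnd ℂ
  have hc : Continuous c := Complex.continuous_conj
  -- `H = -x(|p|² + |q|²) + 2Re(p q̄)` is the flux: `2Re(L₀u|u) + 3‖u‖² = H(1) - H(0)`. Of the
  -- `-4‖u‖²` from the zeroth-order terms, one `‖u‖²` is returned when the derivative falls on `x`.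
  let H : ℝ → ℂ := fun x =>
    -(x : ℂ) * (p x * c (p x) + q x * c (q x)) + (p x * c (q x) + q x * c (p x))
  let H' : ℝ → ℂ := fun x =>
    -(p x * c (p x) + q x * c (q x))
      - x * (p' x * c (p x) + p x * c (p' x) + q' x * c (q x) + q x * c (q' x))
      + (p' x * c (q x) + p x * c (q' x) + q' x * c (p x) + q x * c (p' x))
  have hH : ∀ x ∈ Icc (0 : ℝ) 1, HasDerivWithinAt H (H' x) (Icc 0 1) x := by
    intro x hx
    have h1 : HasDerivWithinAt p (p' x) (Icc 0 1) x :=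
      (hcp.differentiableOn one_ne_zero x hx).hasDerivWithinAt
    have h2 : HasDerivWithinAt q (q' x) (Icc 0 1) x :=
      (hcq.differentiableOn one_ne_zero x hx).hasDerivWithinAt
    have h3 : HasDerivWithinAt (fun y => c (p y)) (c (p' x)) (Icc 0 1) x := h1.star
    have h4 : HasDerivWithinAt (fun y => c (q y)) (c (q' x)) (Icc 0 1) x := h2.star
    have hX : HasDerivWithinAt (fun x : ℝ => (x : ℂ)) 1 (Icc 0 1) x :=
      Complex.ofRealCLM.hasDerivAt.hasDerivWithinAt
    refine HasDerivWithinAt.congr_deriv ((hX.neg.mul ((h1.mul h3).add (h2.mul h4))).add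
      ((h1.mul h4).add (h2.mul h3))) ?_
    simp only [H', Pi.neg_apply, Pi.add_apply, Pi.mul_apply]
    ring
  have hHc' : ContinuousOn H' (Icc 0 1) := by
    have a1 := hc.comp_continuousOn hpc
    have a2 := hc.comp_continuousOn hqc
    have a3 := hc.comp_continuousOn hpc'
    have a4 := hc.comp_continuousOn hqc'
    simp only [Function.comp_def] at a1 a2 a3 a4
    have a5 : ContinuousOn (fun x : ℝ => (x : ℂ)) (Icc 0 1) := by fun_prop
    exact (((hpc.mul a1).add (hqc.mul a2)).neg.sub (a5.mul ((((hpc'.mul a1).add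
      (hpc.mul a3)).add (hqc'.mul a2)).add (hqc.mul a4)))).add ((((hpc'.mul a2).add
      (hpc.mul a4)).add (hqc'.mul a1)).add (hqc.mul a3))
  have hFTC : ∫ x in (0 : ℝ)..1, H' x = H 1 - H 0 :=
    intervalIntegral.integral_eq_sub_of_hasDerivAt_of_le zero_le_one
      (fun x hx => (hH x hx).continuousWithinAt)
      (fun x hx => (hH x (Ioo_subset_Icc_self hx)).hasDerivAt (Icc_mem_nhds hx.1 hx.2))
      (hHc'.intervalIntegrable_of_Icc zero_le_one)
  have hsum : PreEnergySpace.form (freePre u) u.1 + PreEnergySpace.form u.1 (freePre u)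
      + 3 * PreEnergySpace.form u.1 u.1 = ∫ x in (0 : ℝ)..1, H' x := by
    have i := fun v w => PreEnergySpace.integrable_opD_opD v w
    have j := fun v w => PreEnergySpace.integrable_dsnd v w
    rw [PreEnergySpace.form, PreEnergySpace.form, PreEnergySpace.form, mul_add,
      ← intervalIntegral.integral_const_mul, ← intervalIntegral.integral_const_mul,
      ← intervalIntegral.integral_add (i _ _) (j _ _),
      ← intervalIntegral.integral_add (i _ _) (j _ _),
      ← intervalIntegral.integral_add ((i _ _).const_mul 3) ((j _ _).const_mul 3),
      ← intervalIntegral.integral_add ((i _ _).add (j _ _)) ((i _ _).add (j _ _)),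
      ← intervalIntegral.integral_add (((i _ _).add (j _ _)).add ((i _ _).add (j _ _)))
        (((i _ _).const_mul 3).add ((j _ _).const_mul 3))]
    refine PreEnergySpace.integral_congr' fun x hx => ?_
    simp only [opD_opD_freePre u hx, dsnd_freePre u (Ioc_subset_Icc_self hx), ← hp, ← hq, ← hp',
      ← hq', H', map_add, map_sub, map_mul, map_neg, Complex.conj_ofReal, c, Complex.conj_ofNat]
    ring
  -- The convention `opD f 0 = 0` is the true boundary value here: `p` is `C¹` up to `0` for smooth
  -- data, by the vanishing of `u₁⁽⁴⁾(0)`.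
  have hp0 : p 0 = 0 := by rw [hp, opD_zero]
  have hH0 : H 0 = 0 := by simp [H, hp0, c]
  -- `H(1) = -|p(1) - q(1)|²`.
  have hH1 : (H 1).re ≤ 0 := by
    simp only [H, c, Complex.add_re, Complex.mul_re, Complex.add_im, Complex.mul_im,
      Complex.conj_re, Complex.conj_im, Complex.ofReal_one, Complex.neg_re, Complex.neg_im,
      Complex.one_re, Complex.one_im]
    nlinarith [sq_nonneg ((p 1).re - (q 1).re), sq_nonneg ((p 1).im - (q 1).im)]
  have hre := congrArg Complex.re hsum
  rw [hFTC, hH0, sub_zero, ← PreEnergySpace.conj_form (freePre u) u.1] at hre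
  have hn : (PreEnergySpace.form u.1 u.1).re = ‖u.1‖ ^ 2 := by
    rw [PreEnergySpace.norm_sq_eq, PreEnergySpace.form_self, Complex.ofReal_re]
  simp only [Complex.add_re, Complex.conj_re, Complex.mul_re, hn, Complex.re_ofNat,
    Complex.im_ofNat] at hre
  linarith

/-! ### Eigenvectors -/

/-- Every pair of smooth functions `p`, `q` with `p(0) = 0` is of the form `(D² u₁, u₂')` with
smooth data `u`. -/
theorem exists_freeDomain {p q : ℝ → ℂ} (hp : ContDiff ℝ ∞ p) (hq : ContDiff ℝ ∞ q)
    (hp0 : p 0 = 0) : ∃ u : freeDomain, (∀ x ∈ Ioc (0 : ℝ) 1, opD (opD u.1.fst) x = p x) ∧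
      ∀ x ∈ Icc (0 : ℝ) 1, derivWithin u.1.snd (Icc 0 1) x = q x := by
  have hpd : ContDiff ℝ ∞ (deriv p) := (contDiff_infty_iff_deriv.1 hp).2
  have hX : ∀ x, HasDerivWithinAt (fun x : ℝ => (x : ℂ)) 1 (Icc 0 1) x := fun x =>
    Complex.ofRealCLM.hasDerivAt.hasDerivWithinAt
  have hX2 : ∀ x : ℝ, HasDerivWithinAt (fun x : ℝ => (x : ℂ) ^ 2) (2 * (x : ℂ)) (Icc 0 1) x :=
    fun x => HasDerivWithinAt.congr_deriv ((hX x).pow 2) (by norm_num)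
  have hK : ∀ x ∈ Icc (0 : ℝ) 1, HasDerivWithinAt (opK p) ((x : ℂ) * p x) (Icc 0 1) x :=
    fun x hx => hasDerivWithinAt_opK hp.continuous.continuousOn hx
  have hKs : ContDiffOn ℝ ∞ (opK p) (Icc 0 1) := contDiffOn_opK hp.contDiffOn
  -- `K` inverts `D`, so `u₁ = KKp`; these are its derivatives up to order four. Only the fourth
  -- needs `p(0) = 0` in order to vanish at `0`.
  let F : ℕ → ℝ → ℂ
    | 0 => opK (opK p)
    | 1 => fun x => (x : ℂ) * opK p x
    | 2 => fun x => opK p x + (x : ℂ) ^ 2 * p x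
    | 3 => fun x => 3 * ((x : ℂ) * p x) + (x : ℂ) ^ 2 * deriv p x
    | _ => fun x => 3 * p x + 5 * ((x : ℂ) * deriv p x) + (x : ℂ) ^ 2 * deriv (deriv p) x
  have hch : ∀ k < 4, ∀ x ∈ Icc (0 : ℝ) 1,
      HasDerivWithinAt (F k) (F (k + 1) x) (Icc 0 1) x := by
    intro k hk x hx
    have h1 : HasDerivWithinAt p (deriv p x) (Icc 0 1) x :=
      ((hp.differentiable (by simp)) x).hasDerivAt.hasDerivWithinAt
    have h2 : HasDerivWithinAt (deriv p) (deriv (deriv p) x) (Icc 0 1) x :=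
      ((hpd.differentiable (by simp)) x).hasDerivAt.hasDerivWithinAt
    interval_cases k
    · exact hasDerivWithinAt_opK hKs.continuousOn hx
    · refine HasDerivWithinAt.congr_deriv ((hX x).mul (hK x hx)) ?_
      simp only [F]
      ring
    · refine HasDerivWithinAt.congr_deriv ((hK x hx).add ((hX2 x).mul h1)) ?_
      simp only [F]
      ring
    · refine HasDerivWithinAt.congr_deriv ((((hX x).mul h1).const_mul 3).add ((hX2 x).mul h2)) ?_
      simp only [F]
      ring
  have hQ : ∀ x, HasDerivAt (fun y : ℝ => ∫ s in (0 : ℝ)..y, q s) (q x) x := fun x =>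
    (hq.continuous.integral_hasStrictDerivAt 0 x).hasDerivAt
  have hQs : ContDiffOn ℝ ∞ (fun y : ℝ => ∫ s in (0 : ℝ)..y, q s) (Icc 0 1) := by
    refine ContDiff.contDiffOn (contDiff_infty_iff_deriv.2
      ⟨fun x => (hQ x).differentiableAt, ?_⟩)
    rwa [show deriv (fun y : ℝ => ∫ s in (0 : ℝ)..y, q s) = q from funext fun x => (hQ x).deriv]
  set f := (Icc (0 : ℝ) 1).indicator (opK (opK p)) with hf
  set g := (Icc (0 : ℝ) 1).indicator (fun y : ℝ => ∫ s in (0 : ℝ)..y, q s) with hg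
  have e1 : EqOn f (opK (opK p)) (Icc 0 1) := eqOn_indicator
  have e2 : EqOn g (fun y : ℝ => ∫ s in (0 : ℝ)..y, q s) (Icc 0 1) := eqOn_indicator
  have hfs : ContDiffOn ℝ ∞ f (Icc 0 1) := (contDiffOn_opK hKs).congr e1
  have hgs : ContDiffOn ℝ ∞ g (Icc 0 1) := hQs.congr e2
  have hit : ∀ k ≤ 4, ∀ x ∈ Icc (0 : ℝ) 1, iteratedDerivWithin k f (Icc 0 1) x = F k x :=
    fun k hk x hx => (iteratedDerivWithin_congr e1 hx).trans (iter_eq_of_chain hch k hk x hx)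
  have hf0 : ∀ k ≤ 4, iteratedDerivWithin k f (Icc 0 1) 0 = 0 := by
    intro k hk
    rw [hit k hk 0 zero_mem_I]
    interval_cases k <;> simp [F, opK, hp0]
  have hg0 : g 0 = 0 := by rw [e2 zero_mem_I]; simp
  have hpre : IsPreEnergy (f, g) := ⟨fun x hx => ⟨indicator_of_notMem hx (opK (opK p)),
    indicator_of_notMem hx (fun y : ℝ => ∫ s in (0 : ℝ)..y, q s)⟩, hfs.of_le (by exact_mod_cast (lt_infty 4).le),
    hgs.of_le (by exact_mod_cast (lt_infty 1).le), fun k hk => hf0 k (by omega), hg0⟩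
  refine ⟨⟨PreEnergySpace.mk f g hpre, hfs, hgs, hf0, hg0⟩, fun x hx => ?_, fun x hx => ?_⟩
  · have h0 : (x : ℂ) ≠ 0 := by exact_mod_cast hx.1.ne'
    refine (opD_opD (hpre.2.1.of_le (by norm_num)) hx).trans ?_
    change iteratedDerivWithin 2 f _ x / _ - iteratedDerivWithin 1 f _ x / _ = _
    rw [hit 2 (by norm_num) x (Ioc_subset_Icc_self hx),
      hit 1 (by norm_num) x (Ioc_subset_Icc_self hx)]
    simp only [F]
    field_simp
    ring
  · refine (derivWithin_congr e2 (e2 hx)).trans ?_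
    exact (hQ x).hasDerivWithinAt.derivWithin (uniqueDiff_I x hx)

/-- The explicit eigenvectors of the free operator. -/
theorem exists_eigenvector (k : ℕ) : ∃ u : freeDomain,
    (∀ x ∈ Ioc (0 : ℝ) 1,
      opD (opD u.1.fst) x = ((1 + (x : ℂ)) ^ k - (1 - (x : ℂ)) ^ k) / 2) ∧
    (∀ x ∈ Icc (0 : ℝ) 1,
      derivWithin u.1.snd (Icc 0 1) x = -((1 + (x : ℂ)) ^ k + (1 - (x : ℂ)) ^ k) / 2) ∧
    freePre u = (-((k : ℂ) + 2)) • u.1 := by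
  have hof : ContDiff ℝ ∞ fun x : ℝ => (x : ℂ) := Complex.ofRealCLM.contDiff
  have ha : ContDiff ℝ ∞ fun x : ℝ => (1 + (x : ℂ)) ^ k := (contDiff_const.add hof).pow k
  have hb : ContDiff ℝ ∞ fun x : ℝ => (1 - (x : ℂ)) ^ k := (contDiff_const.sub hof).pow k
  -- `p` is the odd part of `(1+x)^k` and `q` is minus its even part, so that `p - q = (1+x)^k`.
  obtain ⟨u, hu1, hu2⟩ := exists_freeDomain (p := fun x : ℝ =>
    ((1 + (x : ℂ)) ^ k - (1 - (x : ℂ)) ^ k) / 2) (q := fun x : ℝ =>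
    -((1 + (x : ℂ)) ^ k + (1 - (x : ℂ)) ^ k) / 2) ((ha.sub hb).div_const 2)
    ((ha.add hb).neg.div_const 2) (by simp)
  refine ⟨u, hu1, hu2, ?_⟩
  have hX : ∀ x : ℝ, HasDerivWithinAt (fun x : ℝ => (x : ℂ)) 1 (Icc 0 1) x := fun x =>
    Complex.ofRealCLM.hasDerivAt.hasDerivWithinAt
  have hda : ∀ x : ℝ, HasDerivWithinAt (fun x : ℝ => (1 + (x : ℂ)) ^ k)
      (k * (1 + (x : ℂ)) ^ (k - 1)) (Icc 0 1) x := fun x => by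
    simpa using ((hX x).const_add 1).fun_pow k
  have hdb : ∀ x : ℝ, HasDerivWithinAt (fun x : ℝ => (1 - (x : ℂ)) ^ k)
      (-(k * (1 - (x : ℂ)) ^ (k - 1))) (Icc 0 1) x := fun x => by
    simpa using ((hX x).const_sub 1).fun_pow k
  -- The factor `k` makes this hold for `k = 0` too, where the exponent `k - 1` is truncated.
  have hpow : ∀ z : ℂ, (k : ℂ) * z ^ k = k * z ^ (k - 1) * z := fun z => by
    rcases k with _ | k
    · simp
    · simp [pow_succ, mul_assoc]
  have hp' : ∀ x ∈ Ioc (0 : ℝ) 1, derivWithin (opD (opD u.1.fst)) (Icc 0 1) x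
      = (k * (1 + (x : ℂ)) ^ (k - 1) + k * (1 - (x : ℂ)) ^ (k - 1)) / 2 := by
    intro x hx
    rw [((((hda x).sub (hdb x)).div_const 2).congr_of_eventuallyEq
      (eventuallyEq_pos hx.1 hu1) (hu1 x hx)).derivWithin
      (uniqueDiff_I x (Ioc_subset_Icc_self hx)), sub_neg_eq_add]
  have hq' : ∀ x ∈ Ioc (0 : ℝ) 1, derivWithin (derivWithin u.1.snd (Icc 0 1)) (Icc 0 1) x
      = (-(k * (1 + (x : ℂ)) ^ (k - 1)) + k * (1 - (x : ℂ)) ^ (k - 1)) / 2 := by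
    intro x hx
    have hxI := Ioc_subset_Icc_self hx
    rw [derivWithin_congr hu2 (hu2 x hxI)]
    refine ((((hda x).add (hdb x)).neg.div_const 2).derivWithin (uniqueDiff_I x hxI)).trans ?_
    ring
  refine PreEnergySpace.ext_opD (fun x hx => ?_) (fun x hx => ?_)
  · rw [opD_opD_freePre u hx, PreEnergySpace.opD_opD_smul _ _ hx, hp' x hx, hq' x hx, hu1 x hx]
    linear_combination (1 / 2) * hpow (1 + x) - (1 / 2) * hpow (1 - x)
  · have hxI := Ioc_subset_Icc_self hx
    rw [dsnd_freePre u hxI, PreEnergySpace.dsnd_smul _ _ hxI, hp' x hx, hq' x hx, hu2 x hxI]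
    linear_combination (-1 / 2) * hpow (1 + x) - (1 / 2) * hpow (1 - x)

/-- The eigenvector of the free operator with eigenvalue `-(k + 2)`. -/
def eigenvector (k : ℕ) : freeDomain := (exists_eigenvector k).choose

theorem opD_opD_eigenvector (k : ℕ) {x : ℝ} (hx : x ∈ Ioc (0 : ℝ) 1) :
    opD (opD (eigenvector k).1.fst) x = ((1 + (x : ℂ)) ^ k - (1 - (x : ℂ)) ^ k) / 2 :=
  (exists_eigenvector k).choose_spec.1 x hx

theorem dsnd_eigenvector (k : ℕ) {x : ℝ} (hx : x ∈ Icc (0 : ℝ) 1) :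
    derivWithin (eigenvector k).1.snd (Icc 0 1) x
      = -((1 + (x : ℂ)) ^ k + (1 - (x : ℂ)) ^ k) / 2 :=
  (exists_eigenvector k).choose_spec.2.1 x hx

theorem freePre_eigenvector (k : ℕ) :
    freePre (eigenvector k) = (-((k : ℂ) + 2)) • (eigenvector k).1 :=
  (exists_eigenvector k).choose_spec.2.2

/-! ### Density of the span of the eigenvectors -/

/-- The combinations of eigenvectors realize `D² u₁ = P_odd`, `u₂' = -P_even` for every
polynomial `P`. -/
theorem exists_linearCombination_eigenvector (P : Polynomial ℂ) : ∃ c : ℕ →₀ ℂ,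
    (∀ x ∈ Ioc (0 : ℝ) 1,
      opD (opD (Finsupp.linearCombination ℂ (fun k => (eigenvector k).1) c).fst) x
        = (P.eval (x : ℂ) - P.eval (-(x : ℂ))) / 2) ∧
    ∀ x ∈ Ioc (0 : ℝ) 1,
      derivWithin (Finsupp.linearCombination ℂ (fun k => (eigenvector k).1) c).snd (Icc 0 1) x
        = -(P.eval (x : ℂ) + P.eval (-(x : ℂ))) / 2 := by
  -- Expansion in powers of `1 + X`, each of which belongs to one eigenvector.
  obtain ⟨Q, rfl⟩ : ∃ Q : Polynomial ℂ, P = Q.comp (Polynomial.X + Polynomial.C 1) :=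
    ⟨P.comp (Polynomial.X - Polynomial.C 1), by simp [Polynomial.comp_assoc]⟩
  simp only [Polynomial.eval_comp, Polynomial.eval_add, Polynomial.eval_X, Polynomial.eval_C]
  induction Q using Polynomial.induction_on' with
  | add Q R hQ hR =>
    obtain ⟨c, hc1, hc2⟩ := hQ
    obtain ⟨d, hd1, hd2⟩ := hR
    refine ⟨c + d, fun x hx => ?_, fun x hx => ?_⟩
    · rw [map_add, PreEnergySpace.opD_opD_add _ _ hx, hc1 x hx, hd1 x hx, Polynomial.eval_add,
        Polynomial.eval_add]
      ring
    · rw [map_add, PreEnergySpace.dsnd_add _ _ (Ioc_subset_Icc_self hx), hc2 x hx, hd2 x hx,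
        Polynomial.eval_add, Polynomial.eval_add]
      ring
  | monomial n a =>
    refine ⟨Finsupp.single n a, fun x hx => ?_, fun x hx => ?_⟩
    · rw [Finsupp.linearCombination_single, PreEnergySpace.opD_opD_smul _ _ hx,
        opD_opD_eigenvector n hx, Polynomial.eval_monomial, Polynomial.eval_monomial]
      ring
    · have hxI := Ioc_subset_Icc_self hx
      rw [Finsupp.linearCombination_single, PreEnergySpace.dsnd_smul _ _ hxI,
        dsnd_eigenvector n hxI, Polynomial.eval_monomial, Polynomial.eval_monomial]
      ring

theorem exists_complex_polynomial_near {f : ℝ → ℂ} {a b : ℝ} (hf : ContinuousOn f (Icc a b))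
    {ε : ℝ} (hε : 0 < ε) :
    ∃ P : Polynomial ℂ, ∀ x ∈ Icc a b, ‖P.eval (x : ℂ) - f x‖ < ε := by
  obtain ⟨P, hP⟩ := exists_polynomial_near_of_continuousOn a b (fun x => (f x).re)
    (Complex.continuous_re.comp_continuousOn hf) (ε / 2) (half_pos hε)
  obtain ⟨Q, hQ⟩ := exists_polynomial_near_of_continuousOn a b (fun x => (f x).im)
    (Complex.continuous_im.comp_continuousOn hf) (ε / 2) (half_pos hε)
  refine ⟨P.map Complex.ofRealHom + Polynomial.C Complex.I * Q.map Complex.ofRealHom,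
    fun x hx => ?_⟩
  have hev : ∀ R : Polynomial ℝ, (R.map Complex.ofRealHom).eval (x : ℂ) = ((R.eval x : ℝ) : ℂ) :=
    fun R => Polynomial.eval_map_apply Complex.ofRealHom x
  rw [Polynomial.eval_add, Polynomial.eval_mul, Polynomial.eval_C, hev, hev]
  refine (Complex.norm_le_abs_re_add_abs_im _).trans_lt ?_
  have h1 := hP x hx
  have h2 := hQ x hx
  simp only [Complex.sub_re, Complex.add_re, Complex.mul_re, Complex.sub_im, Complex.add_im,
    Complex.mul_im, Complex.ofReal_re, Complex.ofReal_im, Complex.I_re, Complex.I_im]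
  ring_nf at h1 h2 ⊢
  linarith

/-- If `u₂'` is small, and `D² u₁` is bounded, and small away from a short interval, then `u` is
small. -/
theorem norm_sq_le_of_small_outside (u : PreEnergySpace) {δ η N : ℝ} (hδ : 0 < δ) (hδ1 : δ ≤ 1)
    (h1 : ∀ x ∈ Ioc (0 : ℝ) 1, ‖opD (opD u.fst) x‖ ≤ N)
    (h2 : ∀ x ∈ Ioc δ 1, ‖opD (opD u.fst) x‖ ≤ η)
    (h3 : ∀ x ∈ Ioc (0 : ℝ) 1, ‖derivWithin u.snd (Icc 0 1) x‖ ≤ η) :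
    ‖u‖ ^ 2 ≤ N ^ 2 * δ + 2 * η ^ 2 := by
  have key : ∀ {f : ℝ → ℂ} {a b C : ℝ}, a ≤ b → (∀ x ∈ Ioc a b, ‖f x‖ ≤ C) →
      ∫ x in a..b, ‖f x‖ ^ 2 ≤ C ^ 2 * (b - a) := by
    intro f a b C hab hf
    refine (le_abs_self _).trans ?_
    have := intervalIntegral.norm_integral_le_of_norm_le_const (a := a) (b := b)
      (f := fun x => ‖f x‖ ^ 2) (C := C ^ 2) fun x hx => by
        rw [uIoc_of_le hab] at hx
        rw [Real.norm_of_nonneg (by positivity)]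
        exact pow_le_pow_left₀ (norm_nonneg _) (hf x hx) 2
    rwa [abs_of_nonneg (sub_nonneg.2 hab)] at this
  have hint : IntervalIntegrable (fun x => ‖opD (opD u.fst) x‖ ^ 2) volume 0 1 := by
    refine (PreEnergySpace.integrable_opD_opD u u).norm.congr fun x _ => ?_
    simp only [norm_mul, RCLike.norm_conj, sq]
  rw [PreEnergySpace.norm_sq_eq, ← intervalIntegral.integral_add_adjacent_intervals (b := δ)
    (hint.mono_set (by rw [uIcc_of_le hδ.le, uIcc_of_le zero_le_one]; gcongr))
    (hint.mono_set (by rw [uIcc_of_le hδ1, uIcc_of_le zero_le_one]; gcongr))]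
  have i1 := key hδ.le fun x hx => h1 x ⟨hx.1, hx.2.trans hδ1⟩
  have i2 := key hδ1 h2
  have i3 := key zero_le_one h3
  nlinarith [sq_nonneg η]

/-- Weierstrass on `[-1,1]`, applied to the odd extension of `p` minus the even extension of `q`.
For a general `v` the limit of `p` at `0` need not vanish, so the odd extension may jump there; it
is first cut off near `0`, which costs little in `L²`. -/
theorem denseRange_linearCombination_eigenvector :
    DenseRange (Finsupp.linearCombination ℂ fun k => (eigenvector k).1) := by
  intro v
  rw [Metric.mem_closure_range_iff]
  intro ε hε
  obtain ⟨g, hg, hgv⟩ := v.exists_rep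
  set q := derivWithin v.snd (Icc 0 1) with hq
  have hqc : ContinuousOn q (Icc 0 1) := v.continuousOn_dsnd
  obtain ⟨M, hM⟩ := isCompact_Icc.exists_bound_of_continuousOn hg
  have hM0 : 0 ≤ M := (norm_nonneg _).trans (hM 0 zero_mem_I)
  set η := ε / 2 with hη
  have hη0 : 0 < η := half_pos hε
  -- The cutoff region contributes at most `(η + M)²δ ≤ η²`, so the squared error is at most `3η² <
  -- (2η)² = ε²`.
  set δ := min 1 (η ^ 2 / (η + M) ^ 2) with hδ
  have hδ0 : 0 < δ := lt_min one_pos (by positivity)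
  have hδ2 : (η + M) ^ 2 * δ ≤ η ^ 2 := by
    rw [← le_div_iff₀' (by positivity)]
    exact min_le_right _ _
  have habs : MapsTo (fun x : ℝ => |x|) (Icc (-1) 1) (Icc 0 1) := fun x hx =>
    ⟨abs_nonneg x, abs_le.2 hx⟩
  -- A continuous odd replacement for the sign function, equal to it where `|x| ≥ δ`.
  let χ : ℝ → ℝ := fun x => x / max |x| δ
  have hχc : Continuous χ := continuous_id.div (by fun_prop) fun x =>
    (lt_max_of_lt_right hδ0).ne'
  have hf : ContinuousOn (fun x : ℝ => g |x| * (χ x : ℂ) - q |x|) (Icc (-1) 1) :=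
    ((hg.comp continuous_abs.continuousOn habs).mul
      (Complex.continuous_ofReal.comp hχc).continuousOn).sub
      (hqc.comp continuous_abs.continuousOn habs)
  obtain ⟨P, hP⟩ := exists_complex_polynomial_near hf hη0
  obtain ⟨c, hc1, hc2⟩ := exists_linearCombination_eigenvector P
  refine ⟨c, ?_⟩
  set w := Finsupp.linearCombination ℂ (fun k => (eigenvector k).1) c with hw
  have hpos : ∀ x ∈ Ioc (0 : ℝ) 1, ‖P.eval (x : ℂ) - (g x * (χ x : ℂ) - q x)‖ ≤ η := by
    intro x hx
    have := (hP x ⟨by linarith [hx.1], hx.2⟩).le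
    rwa [abs_of_pos hx.1] at this
  have hneg : ∀ x ∈ Ioc (0 : ℝ) 1, ‖P.eval (-(x : ℂ)) - (-(g x * (χ x : ℂ)) - q x)‖ ≤ η := by
    intro x hx
    have := (hP (-x) ⟨by linarith [hx.2], by linarith [hx.1]⟩).le
    simp only [χ, abs_neg, abs_of_pos hx.1, neg_div, Complex.ofReal_neg, mul_neg] at this ⊢
    exact this
  -- Taking the odd part averages the errors at `x` and `-x`, so the bound `η` persists.
  have hodd : ∀ x ∈ Ioc (0 : ℝ) 1,
      ‖g x * (χ x : ℂ) - (P.eval (x : ℂ) - P.eval (-(x : ℂ))) / 2‖ ≤ η := by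
    intro x hx
    rw [show g x * (χ x : ℂ) - (P.eval (x : ℂ) - P.eval (-(x : ℂ))) / 2
      = ((P.eval (-(x : ℂ)) - (-(g x * (χ x : ℂ)) - q x))
        - (P.eval (x : ℂ) - (g x * (χ x : ℂ) - q x))) / 2 by ring, norm_div, Complex.norm_two]
    linarith [norm_sub_le (P.eval (-(x : ℂ)) - (-(g x * (χ x : ℂ)) - q x))
      (P.eval (x : ℂ) - (g x * (χ x : ℂ) - q x)), hpos x hx, hneg x hx]
  have hD : ∀ x ∈ Ioc (0 : ℝ) 1, opD (opD (v + (-1 : ℂ) • w).fst) x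
      = g x * (1 - χ x : ℝ) + (g x * (χ x : ℂ) - (P.eval (x : ℂ) - P.eval (-(x : ℂ))) / 2) := by
    intro x hx
    rw [PreEnergySpace.opD_opD_add _ _ hx, PreEnergySpace.opD_opD_smul _ _ hx, hc1 x hx, hgv x hx]
    push_cast
    ring
  have hbound := norm_sq_le_of_small_outside (v + (-1 : ℂ) • w) (N := η + M) (η := η) hδ0
    (min_le_left _ _) (fun x hx => ?_) (fun x hx => ?_) (fun x hx => ?_)
  · rw [dist_eq_norm, sub_eq_add_neg, ← neg_one_smul ℂ w]
    have : ‖v + (-1 : ℂ) • w‖ ^ 2 < ε ^ 2 := by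
      have : ε = 2 * η := by rw [hη]; ring
      nlinarith
    exact lt_of_pow_lt_pow_left₀ 2 hε.le this
  · have hχ : |1 - χ x| ≤ 1 := by
      have h0 : 0 ≤ χ x := div_nonneg hx.1.le (le_max_of_le_right hδ0.le)
      have h1 : χ x ≤ 1 :=
        div_le_one_of_le₀ ((le_abs_self x).trans (le_max_left _ _)) (le_max_of_le_right hδ0.le)
      exact abs_le.2 ⟨by linarith, by linarith⟩
    rw [hD x hx]
    refine (norm_add_le _ _).trans ?_
    rw [norm_mul, Complex.norm_real, Real.norm_eq_abs]
    have := mul_le_mul (hM x (Ioc_subset_Icc_self hx)) hχ (abs_nonneg _) hM0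
    linarith [hodd x hx]
  · have hx' : x ∈ Ioc (0 : ℝ) 1 := ⟨hδ0.trans hx.1, hx.2⟩
    have hχ : χ x = 1 := by
      simp only [χ]
      rw [abs_of_pos hx'.1, max_eq_left hx.1.le, div_self hx'.1.ne']
    have h := hodd x hx'
    rw [hD x hx']
    simpa [hχ] using h
  · have hxI := Ioc_subset_Icc_self hx
    rw [PreEnergySpace.dsnd_add _ _ hxI, PreEnergySpace.dsnd_smul _ _ hxI, hc2 x hx, ← hq,
      show q x + -1 * (-(P.eval (x : ℂ) + P.eval (-(x : ℂ))) / 2)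
      = ((P.eval (-(x : ℂ)) - (-(g x * (χ x : ℂ)) - q x))
        + (P.eval (x : ℂ) - (g x * (χ x : ℂ) - q x))) / 2 by ring, norm_div, Complex.norm_two]
    linarith [norm_add_le (P.eval (-(x : ℂ)) - (-(g x * (χ x : ℂ)) - q x))
      (P.eval (x : ℂ) - (g x * (χ x : ℂ) - q x)), hpos x hx, hneg x hx]

/-! ### Application to the free operator -/

theorem hasTotalEigenvectors_freeOperator : HasTotalEigenvectors freeOperator (3 / 2)
    (fun k => embed (eigenvector k).1) fun k => -((k : ℂ) + 2) where
  pos := by norm_num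
  dissipative x y hxy := by
    obtain ⟨u, rfl, rfl⟩ := (mem_graph_freeOperator x y).1 hxy
    have h1 : inner ℂ (embed u.1) (embed (freePre u)) = PreEnergySpace.form (freePre u) u.1 :=
      UniformSpace.Completion.inner_coe _ _
    have h2 : ‖embed u.1‖ = ‖u.1‖ := UniformSpace.Completion.norm_coe _
    rw [h1, h2]
    exact re_form_freePre_le u
  mem_graph k := (mem_graph_freeOperator _ _).2
    ⟨eigenvector k, rfl, by rw [freePre_eigenvector, map_smul]⟩
  ne_zero k := neg_ne_zero.2 (by exact_mod_cast Nat.succ_ne_zero (k + 1))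
  dense := by
    have h : ⇑(Finsupp.linearCombination ℂ fun k => embed (eigenvector k).1)
        = embed ∘ Finsupp.linearCombination ℂ fun k => (eigenvector k).1 := by
      funext c
      simp only [Function.comp, Finsupp.apply_linearCombination, Function.comp_def]
    rw [h]
    exact UniformSpace.Completion.denseRange_coe.comp denseRange_linearCombination_eigenvector
      (UniformSpace.Completion.continuous_coe _)

end YangMills

end

theorem lemma3p3 :
    YangMills.freeOperator.IsClosable ∧
    ∃ S : ℝ≥0 → YangMills.EnergySpace →L[ℂ] YangMills.EnergySpace,
      YangMills.IsC0Semigroup S ∧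
      YangMills.IsGenerator YangMills.freeOperator.closure S ∧
      (∀ τ : ℝ≥0, ‖S τ‖ ≤ Real.exp (-(3 / 2) * (τ : ℝ))) ∧
      ∀ u : YangMills.EnergySpace,
        YangMills.IsMildSolution YangMills.freeOperator.closure u (fun τ => S τ u) ∧
        ∀ Φ : ℝ≥0 → YangMills.EnergySpace,
          YangMills.IsMildSolution YangMills.freeOperator.closure u Φ → Φ = fun τ => S τ u := by
  have h := YangMills.hasTotalEigenvectors_freeOperator
  exact ⟨h.isClosable, _, h.isC0Semigroup, h.isGenerator, h.norm_semigroup_le,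
    fun u => ⟨h.isMildSolution u, fun Φ hΦ => h.eq_of_isMildSolution hΦ (h.isMildSolution u)⟩⟩
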